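/- All graphs are finite and simple. The odd-girth of a graph is the smallest length of an odd cycle in it (and is $\infty$ for bipartite graphs). Let $\mathcal{SP}_5$ be the class of $K_4$-minor-free graphs of odd-girth at least $5$. A graph $B$ bounds $\mathcal{SP}_5$ if every graph in $\mathcal{SP}_5$ admits a homomorphism to $B$. Let $C_8^{++}$ be the graph obtained from the $8$-cycle $v_1v_2\cdots v_8$ by adding the two antipodal chords $v_1v_5$ and $v_3v_7$; it has $8$ vertices and $10$ edges. Theorem. The graph $C_8^{++}$ has odd-girth $5$ and bounds $\mathcal{SP}_5$. Moreover, every graph $B$ of odd-girth $5$ that bounds $\mathcal{SP}_5$ has at least $8$ vertices and at least $10$ edges, and if $B$ has exactly $8$ vertices and exactly $10$ edges, then $B$ is isomorphic to $C_8^{++}$. Thus $C_8^{++}$ is, up to isomorphism, the unique bound of odd-girth $5$ for $\mathcal{SP}_5$ that is optimal both in terms of order and size. -/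

import Mathlib

namespace HomBounds

/-- The odd-girth of a graph: the smallest length of an odd cycle, and `⊤` if the graph has no
odd cycle (that is, if it is bipartite). -/
noncomputable def oddGirth {V : Type*} (G : SimpleGraph V) : ℕ∞ :=
  ⨅ a, ⨅ w : G.Walk a a, ⨅ _ : w.IsCycle ∧ Odd w.length, (w.length : ℕ∞)

/-- `H` is a minor of `G`: there are pairwise disjoint, nonempty, connected branch sets in `G`,
one for each vertex of `H`, such that adjacent vertices of `H` have branch sets joined by an edge
of `G`. (`SimpleGraph.Connected` includes non-emptiness.) -/
def IsMinor {U V : Type*} (H : SimpleGraph U) (G : SimpleGraph V) : Prop :=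
  ∃ S : U → Set V,
    (∀ u, (G.induce (S u)).Connected) ∧
    (∀ u v, u ≠ v → Disjoint (S u) (S v)) ∧
    (∀ u v, H.Adj u v → ∃ x ∈ S u, ∃ y ∈ S v, G.Adj x y)

/-- Membership in the class of `K₄`-minor-free graphs of odd-girth at least `g`. -/
def MemSP (g : ℕ) {V : Type*} (G : SimpleGraph V) : Prop :=
  ¬ IsMinor (SimpleGraph.completeGraph (Fin 4)) G ∧ (g : ℕ∞) ≤ oddGirth G

/-- `B` bounds the class of finite `K₄`-minor-free graphs of odd-girth at least `g`: every graph
of that class admits a homomorphism to `B`. -/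
def BoundsSP (g : ℕ) {W : Type*} (B : SimpleGraph W) : Prop :=
  ∀ (V : Type) [Finite V] (G : SimpleGraph V), MemSP g G → Nonempty (G →g B)

/-- The graph `C₈⁺⁺`: the cycle `0, 1, …, 7` together with the two antipodal chords
`{0, 4}` and `{2, 6}`. -/
def C8pp : SimpleGraph (Fin 8) :=
  SimpleGraph.cycleGraph 8 ⊔ SimpleGraph.edge 0 4 ⊔ SimpleGraph.edge 2 6

end HomBounds

/-! ### Minors, contractions and vertices with few neighbours -/

namespace HomBounds
open SimpleGraph

/-! Upper bound. A nonempty finite `K₄`-minor-free graph has a vertex `v` with at most two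
neighbours (`exists_low`). Contracting `v` into one of them joins the two, so the induction has to
colour graphs with two sorts of edges: unit edges, which go to adjacent vertices of `C8pp`, and the
others, which go to vertices at distance two (`exists_mixed_coloring`). It closes up because of a
finite check, `rel_extend`: a pair of either sort in `C8pp` extends to a triangle whose other two
sides have prescribed sorts, unless all three sides are to be unit.

Lower bound. Every finite bound `B` contains a structure with the same extension property. Start
from an edge and repeatedly glue to every edge triangles of all admissible sorts. Finite pieces of
the resulting infinite 2-tree have no `K₄` minor and its unit edges form no triangle, so by
compactness its unit graph maps to `B` (`exists_hom_unitTree`). The images of the two sorts of edges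
form an `IsClosedPair`, with graph `G` and relation `D`.

In a closed pair each vertex has at least four `D`-neighbours (`exists_four`), so its degree is at
most the order minus five; all degrees are at least two, and vertices of degree two are never
adjacent. Counting then gives order at least 8 and size at least 10. With 8 vertices and 10 edges,
the surroundings of a vertex of degree two force a spanning copy of `C8pp` (`exists_C8pp`), and
equality of edge numbers makes it an isomorphism. -/

theorem reachable_map {V W : Type*} {G : SimpleGraph V} {H : SimpleGraph W} (r : V → W)
    (h : ∀ a b, G.Adj a b → H.Reachable (r a) (r b)) {a b : V} (hab : G.Reachable a b) :
    H.Reachable (r a) (r b) := by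
  obtain ⟨w⟩ := hab
  induction w with
  | nil => exact Reachable.refl _
  | cons hadj _ ih => exact (h _ _ hadj).trans ih

theorem reachable_induce_mono {V : Type*} {G : SimpleGraph V} {s t : Set V} (hst : s ⊆ t)
    {a b : s} (h : (G.induce s).Reachable a b) :
    (G.induce t).Reachable ⟨a, hst a.2⟩ ⟨b, hst b.2⟩ :=
  reachable_map (fun x : s => (⟨x, hst x.2⟩ : t))
    (fun _ _ hab => Adj.reachable (G := G.induce t) hab) h

theorem IsMinor.mono {U V : Type*} {H : SimpleGraph U} {G G' : SimpleGraph V} (hle : G ≤ G')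
    (h : IsMinor H G) : IsMinor H G' := by
  obtain ⟨S, hS, hd, hadj⟩ := h
  refine ⟨S, fun u => (hS u).mono (fun _ _ hab => hle hab), hd, fun u v huv => ?_⟩
  obtain ⟨x, hx, y, hy, hxy⟩ := hadj u v huv
  exact ⟨x, hx, y, hy, hle hxy⟩

theorem IsMinor.trans {T U V : Type*} {K : SimpleGraph T} {H : SimpleGraph U} {G : SimpleGraph V}
    (hKH : IsMinor K H) (hHG : IsMinor H G) : IsMinor K G := by
  obtain ⟨S, hS, hSd, hSa⟩ := hKH
  obtain ⟨R, hR, hRd, hRa⟩ := hHG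
  refine ⟨fun t => {x | ∃ a ∈ S t, x ∈ R a}, fun t => ?_, fun t t' htt' => ?_, fun t t' htt' => ?_⟩
  · set X : Set V := {x | ∃ a ∈ S t, x ∈ R a}
    have hsub : ∀ a ∈ S t, R a ⊆ X := fun a ha x hx => ⟨a, ha, hx⟩
    have hne : ∀ a, ∃ x, x ∈ R a := fun a => by
      obtain ⟨x⟩ := (hR a).nonempty
      exact ⟨x, x.2⟩
    -- A representative of each inner branch set: walks in `H` between branch sets become walks in
    -- `G` between representatives.
    choose ρ hρ using hne
    have hin : ∀ a (ha : a ∈ S t) x (hx : x ∈ R a) y (hy : y ∈ R a),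
        (G.induce X).Reachable ⟨x, hsub a ha hx⟩ ⟨y, hsub a ha hy⟩ := fun a ha x hx y hy =>
      reachable_induce_mono (hsub a ha) ((hR a).preconnected ⟨x, hx⟩ ⟨y, hy⟩)
    have hrep : ∀ a b : S t, (G.induce X).Reachable ⟨ρ a, hsub a a.2 (hρ a)⟩
        ⟨ρ b, hsub b b.2 (hρ b)⟩ := fun a b =>
      reachable_map (fun a : S t => (⟨ρ a, hsub a a.2 (hρ a)⟩ : X)) (fun a b hab => by
        obtain ⟨x, hx, y, hy, hxy⟩ := hRa a b hab
        have h1 : (G.induce X).Adj ⟨x, hsub a a.2 hx⟩ ⟨y, hsub b b.2 hy⟩ := hxy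
        exact (hin a a.2 _ (hρ a) x hx).trans (h1.reachable.trans (hin b b.2 y hy _ (hρ b))))
        ((hS t).preconnected a b)
    obtain ⟨a₀⟩ := (hS t).nonempty
    have : Nonempty X := ⟨⟨ρ a₀, hsub a₀ a₀.2 (hρ a₀)⟩⟩
    refine Connected.mk ?_
    rintro ⟨x, a, ha, hx⟩ ⟨y, b, hb, hy⟩
    exact (hin a ha x hx _ (hρ a)).trans ((hrep ⟨a, ha⟩ ⟨b, hb⟩).trans (hin b hb _ (hρ b) y hy))
  · rw [Set.disjoint_left]
    rintro x ⟨a, ha, hx⟩ ⟨b, hb, hx'⟩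
    have hab : a ≠ b := by
      rintro rfl
      exact Set.disjoint_left.1 (hSd t t' htt') ha hb
    exact Set.disjoint_left.1 (hRd a b hab) hx hx'
  · obtain ⟨a, ha, b, hb, hab⟩ := hSa t t' htt'
    obtain ⟨x, hx, y, hy, hxy⟩ := hRa a b hab
    exact ⟨x, ⟨a, ha, hx⟩, y, ⟨b, hb, hy⟩, hxy⟩

theorem connected_induce_singleton {V : Type*} (G : SimpleGraph V) (v : V) :
    (G.induce {v}).Connected :=
  Connected.mk fun a b => by rw [Subsingleton.elim a b]

theorem isMinor_of_injective {U V : Type*} {H : SimpleGraph U} {G : SimpleGraph V} (f : U → V)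
    (hf : Function.Injective f) (hadj : ∀ u v, H.Adj u v → G.Adj (f u) (f v)) : IsMinor H G :=
  ⟨fun u => {f u}, fun u => connected_induce_singleton G (f u),
    fun u v huv => by simpa using fun h => huv (hf h),
    fun u v huv => ⟨f u, rfl, f v, rfl, hadj u v huv⟩⟩

/-- The graph obtained by contracting the set `S` to its element `s`. -/
def contract {V : Type*} (G : SimpleGraph V) (S : Set V) (s : V) :
    SimpleGraph {v // v ∉ S ∨ v = s} where
  Adj u v := u ≠ v ∧ (G.Adj u v ∨ ((u : V) = s ∧ ∃ a ∈ S, G.Adj a v) ∨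
    ((v : V) = s ∧ ∃ a ∈ S, G.Adj u a))
  symm := ⟨by
    rintro u v ⟨hne, h | ⟨h, a, ha, h'⟩ | ⟨h, a, ha, h'⟩⟩
    · exact ⟨hne.symm, Or.inl h.symm⟩
    · exact ⟨hne.symm, Or.inr (Or.inr ⟨h, a, ha, h'.symm⟩)⟩
    · exact ⟨hne.symm, Or.inr (Or.inl ⟨h, a, ha, h'.symm⟩)⟩⟩
  loopless := ⟨fun u h => h.1 rfl⟩

theorem contract_isMinor {V : Type*} {G : SimpleGraph V} {S : Set V} {s : V} (hs : s ∈ S)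
    (hS : (G.induce S).Connected) : IsMinor (contract G S s) G := by
  classical
  refine ⟨fun u => if (u : V) = s then S else {(u : V)}, fun u => ?_, fun u v huv => ?_,
    fun u v huv => ?_⟩
  · dsimp only
    by_cases h : (u : V) = s
    · rwa [if_pos h]
    · rw [if_neg h]
      exact connected_induce_singleton G _
  · have huv' : (u : V) ≠ v := fun h => huv (Subtype.ext h)
    have hu := u.2
    have hv := v.2
    rw [Set.disjoint_left]
    intro x
    dsimp only
    split_ifs with h1 h2 h2 <;> grind
  · obtain ⟨hne, h⟩ := huv
    dsimp only
    have huv' : (u : V) ≠ v := fun h => hne (Subtype.ext h)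
    rcases h with h | ⟨h, a, ha, h'⟩ | ⟨h, a, ha, h'⟩
    · exact ⟨u, by split_ifs <;> grind, v, by split_ifs <;> grind, h⟩
    · exact ⟨a, by rwa [if_pos h], v, by rw [if_neg (fun h' => huv' (h.trans h'.symm))]; rfl, h'⟩
    · exact ⟨u, by rw [if_neg (fun h' => huv' (h'.trans h.symm))]; rfl, a, by rwa [if_pos h], h'⟩

/-- All neighbours of `v` are among two vertices. -/
def Low {V : Type*} (G : SimpleGraph V) (v : V) : Prop :=
  ∃ a b, ∀ w, G.Adj v w → w = a ∨ w = b

theorem connected_induce_insert {V : Type*} {G : SimpleGraph V} {S : Set V} {s v : V} (hs : s ∈ S)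
    (hS : (G.induce S).Connected) (h : G.Adj v s) : (G.induce (insert v S)).Connected := by
  have := induce_union_connected (induce_pair_connected_of_adj h).preconnected hS.preconnected
    ⟨s, Or.inr rfl, hs⟩
  have heq : ({v, s} ∪ S : Set V) = insert v S := by grind
  rw [heq] at this
  exact this

theorem isMinor_four_of_adj {V : Type*} {G : SimpleGraph V} {a b c d : V} (h1 : G.Adj a b)
    (h2 : G.Adj a c) (h3 : G.Adj a d) (h4 : G.Adj b c) (h5 : G.Adj b d) (h6 : G.Adj c d) :
    IsMinor (completeGraph (Fin 4)) G := by
  have key : ∀ u v : Fin 4, u ≠ v → G.Adj (![a, b, c, d] u) (![a, b, c, d] v) := by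
    intro u v huv
    fin_cases u <;> fin_cases v <;> simp_all [G.adj_comm]
  exact isMinor_of_injective ![a, b, c, d]
    (fun u v h => by by_contra huv; exact G.ne_of_adj (key u v huv) h)
    (fun u v huv => key u v huv)

end HomBounds

/-! ### `K₄`-minor-free graphs have a vertex with at most two neighbours -/

namespace HomBounds
open SimpleGraph

/-- In a minimal counterexample every vertex but `x` has at least three neighbours, while every
suitable contraction has a low vertex other than `x`. The freedom to exclude `x` strengthens the
induction: when the contracted set contains `x`, the merged vertex is not the low one, so the low
vertex has lost a neighbour and was adjacent to two contracted vertices. Contractions around `x`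
force more and more structure, until it is contradictory. -/
theorem exists_low_ne {n : ℕ} : ∀ {V : Type*} [Finite V] (G : SimpleGraph V), Nat.card V = n →
    ¬ IsMinor (completeGraph (Fin 4)) G → ∀ x y : V, y ≠ x → ∃ v, v ≠ x ∧ Low G v := by
  induction n using Nat.strong_induction_on with
  | _ n ih =>
  classical
  intro V _ G hn hG x y hyx
  by_contra! hlow
  have low_def : ∀ v, v ≠ x → ∀ a b, ∃ w, G.Adj v w ∧ w ≠ a ∧ w ≠ b := by
    intro v hv a b
    by_contra! h
    exact hlow v hv ⟨a, b, fun w hw => by grind⟩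
  have hsymm : ∀ u v, G.Adj u v → G.Adj v u := fun u v h => h.symm
  have hne : ∀ u v, G.Adj u v → u ≠ v := fun u v h => G.ne_of_adj h
  -- contraction of a connected set produces a low vertex
  have hcon : ∀ (S : Set V) (s p : V), s ∈ S → p ∈ S → p ≠ s → (G.induce S).Connected →
      x ∉ S ∨ x = s → (∃ q, q ≠ x ∧ (q ∉ S ∨ q = s)) →
      ∃ v a b, v ≠ x ∧ (v ∉ S ∨ v = s) ∧
        (∀ w, w ≠ v → w ∉ S ∨ w = s → (G.Adj v w ∨ (v = s ∧ ∃ c ∈ S, G.Adj c w) ∨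
          (w = s ∧ ∃ c ∈ S, G.Adj v c)) → w = a ∨ w = b) := by
    intro S s p hs hp hps hS hx ⟨q, hqx, hq⟩
    have hlt : Nat.card {v // v ∉ S ∨ v = s} < n := by
      rw [← hn]
      exact Finite.card_subtype_lt (x := p) (by grind)
    obtain ⟨v, hvx, a, b, hab⟩ := ih _ hlt (contract G S s) rfl
      (fun h => hG (h.trans (contract_isMinor hs hS))) ⟨x, hx⟩ ⟨q, hq⟩
      (fun h => hqx (congrArg Subtype.val h))
    refine ⟨v, a, b, fun h => hvx (Subtype.ext h), v.2, fun w hwv hw h => ?_⟩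
    rcases hab ⟨w, hw⟩ ⟨fun h => hwv (congrArg Subtype.val h).symm, h⟩ with h | h
    · exact Or.inl (congrArg Subtype.val h)
    · exact Or.inr (congrArg Subtype.val h)
  -- Contract `xz` to `x`: the low vertex was adjacent to both ends and had exactly one further
  -- neighbour.
  have triangle : ∀ z, G.Adj x z → ∃ w t, G.Adj x w ∧ G.Adj w z ∧ t ≠ x ∧ t ≠ z ∧ G.Adj w t ∧
      ∀ u, G.Adj w u → u = x ∨ u = z ∨ u = t := by
    intro z hxz
    obtain ⟨q, hq, hqx, hqz⟩ := low_def z (hne _ _ hxz).symm x z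
    obtain ⟨v, a, b, hvx, hvS, hv⟩ := hcon {x, z} x z (by simp) (by simp) (hne _ _ hxz).symm
      (induce_pair_connected_of_adj hxz) (Or.inr rfl) ⟨q, hqx, Or.inl (by simp [hqx, hqz])⟩
    clear hcon ih hlow
    have f1 : ∀ w, w ≠ z → G.Adj v w → w = a ∨ w = b := fun w hw h =>
      hv w (hne _ _ h).symm (by grind) (Or.inl h)
    have f2 : G.Adj v z → x = a ∨ x = b := fun h =>
      hv x hvx.symm (Or.inr rfl) (Or.inr (Or.inr ⟨rfl, z, by simp, h⟩))
    have hvz : G.Adj v z := by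
      by_contra h
      obtain ⟨w, hw⟩ := low_def v hvx a b
      grind
    have hvx' : G.Adj v x := by
      by_contra h
      -- If `v` is adjacent to `z`, then `x` occupies one of the two slots `a`, `b`; the `if` picks
      -- the other one.
      obtain ⟨w, hw⟩ := low_def v hvx z (if x = a then b else a)
      grind
    obtain ⟨t, hvt, htx, htz⟩ := low_def v hvx x z
    exact ⟨v, t, hvx'.symm, hvz, htx, htz, hvt, by grind⟩
  -- Contract `ww'`. If `t ≠ t'`, the merged vertex keeps the three neighbours `x`, `t`, `t'`, and
  -- no vertex other than `x` is adjacent to both `w` and `w'`, so nothing but `x` can be low.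
  have diamond : ∀ w w' t t', G.Adj x w → G.Adj x w' → G.Adj w w' → G.Adj w t → G.Adj w' t' →
      t ≠ x → t ≠ w' → t' ≠ x → t' ≠ w → (∀ u, G.Adj w u → u = x ∨ u = w' ∨ u = t) →
      (∀ u, G.Adj w' u → u = x ∨ u = w ∨ u = t') → t = t' := by
    intro w w' t t' hxw hxw' hww' hwt hwt' htx htw' htx' htw hw hw'
    by_contra htt
    obtain ⟨v, a, b, hvx, hvS, hv⟩ := hcon {w, w'} w w' (by simp) (by simp) (hne _ _ hww').symm
      (induce_pair_connected_of_adj hww') 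
      (Or.inl (by simp [hne _ _ hxw, hne _ _ hxw'])) ⟨w, (hne _ _ hxw).symm, Or.inr rfl⟩
    clear hcon ih hlow triangle
    have f1 : ∀ u, u ≠ w' → G.Adj v u → u = a ∨ u = b := fun u hu h =>
      hv u (hne _ _ h).symm (by grind) (Or.inl h)
    by_cases hvw : v = w
    · subst hvw
      have f3 : t' = a ∨ t' = b := hv t' htw (by grind)
        (Or.inr (Or.inl ⟨rfl, w', by simp, hwt'⟩))
      grind
    · have f2 : G.Adj v w' → w = a ∨ w = b := fun h =>
        hv w (Ne.symm hvw) (Or.inr rfl) (Or.inr (Or.inr ⟨rfl, w', by simp, h⟩))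
      obtain ⟨u, hu⟩ := low_def v hvx a b
      obtain ⟨u', hu'⟩ := low_def v hvx w' (if w = a then b else a)
      grind
  by_cases hiso : ∃ z, G.Adj x z
  · obtain ⟨z, hxz⟩ := hiso
    obtain ⟨w, t₀, hxw, hwz, ht₀x, ht₀z, hwt₀, hw⟩ := triangle z hxz
    obtain ⟨w', t', hxw', hww', htx', htw', hwt', hw'⟩ := triangle w hxw
    have hw'' : ∃ t, G.Adj w t ∧ t ≠ x ∧ t ≠ w' ∧ ∀ u, G.Adj w u → u = x ∨ u = w' ∨ u = t := by
      clear hcon triangle diamond ih hlow hw'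
      by_cases h : w' = z
      · exact ⟨t₀, hwt₀, ht₀x, h ▸ ht₀z, h ▸ hw⟩
      · have h' : w' = t₀ := by grind
        exact ⟨z, hwz, (hne _ _ hxz).symm, Ne.symm h, by grind⟩
    obtain ⟨t, hwt, htx, htw'', hwN⟩ := hw''
    obtain rfl := diamond w w' t t' hxw hxw' hww'.symm hwt hwt' htx htw'' htx' htw' hwN hw'
    have hxt : ¬ G.Adj x t := fun h =>
      hG (isMinor_four_of_adj hxw hxw' h hww'.symm hwt hwt')
    have hS3 : (G.induce {w', x, w}).Connected :=
      connected_induce_insert (s := x) (by simp) (induce_pair_connected_of_adj hxw) hxw'.symm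
    have hS4 : (G.induce {t, w', x, w}).Connected :=
      connected_induce_insert (s := w') (by simp) hS3 hwt'.symm
    -- Outside the triangle `x w w'`, only `t` is adjacent to two of its vertices, so `t` becomes
    -- low when it is contracted.
    have hs : ∃ s, G.Adj t s ∧ s ≠ w ∧ s ≠ w' ∧ s ≠ x ∧
        ∀ u, G.Adj t u → u = w ∨ u = w' ∨ u = s := by
      obtain ⟨v, a, b, hvx, hvS, hv⟩ := hcon _ x w (by simp) (by simp) (hne _ _ hxw).symm hS3
        (Or.inr rfl) ⟨t, htx, Or.inl (by simp [htx, htw', htw''])⟩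
      have f1 : ∀ u, u ∉ ({w', x, w} : Set V) → G.Adj v u → u = a ∨ u = b := fun u hu h =>
        hv u (hne _ _ h).symm (Or.inl hu) (Or.inl h)
      have f2 : ∀ c ∈ ({w', x, w} : Set V), G.Adj v c → x = a ∨ x = b := fun c hc h =>
        hv x hvx.symm (Or.inr rfl) (Or.inr (Or.inr ⟨rfl, c, hc, h⟩))
      simp only [Set.mem_insert_iff, Set.mem_singleton_iff, not_or] at f1 f2 hvS
      clear hcon triangle diamond ih hlow hv
      obtain rfl : v = t := by
        obtain ⟨u, hu⟩ := low_def v hvx a b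
        grind
      obtain ⟨s, hs1, hs2, hs3⟩ := low_def v hvx w w'
      have hsx : s ≠ x := fun h => hxt (h ▸ hs1).symm
      have f3 := f2 w (by simp) hwt.symm
      have f4 := f1 s ⟨hs3, hsx, hs2⟩ hs1
      refine ⟨s, hs1, hs2, hs3, hsx, fun u hu => ?_⟩
      have hux : u ≠ x := fun h => hxt (h ▸ hu).symm
      have f5 := fun h => f1 u h hu
      clear low_def hsymm hne hw f1 f2 hw'
      grind
    obtain ⟨s, hts, hsw, hsw', hsx, htN⟩ := hs
    -- With `t` contracted as well, only `s` can have lost a neighbour, and only by being adjacent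
    -- to both `t` and `x`.
    have hu : G.Adj s x ∧ ∃ u, ∀ v, G.Adj s v → v = x ∨ v = t ∨ v = u := by
      obtain ⟨v, a, b, hvx, hvS, hv⟩ := hcon _ x w (by simp) (by simp) (hne _ _ hxw).symm hS4
        (Or.inr rfl) ⟨s, hsx, Or.inl (by simp [hsx, hsw, hsw', (hne _ _ hts).symm])⟩
      have f1 : ∀ u, u ∉ ({t, w', x, w} : Set V) → G.Adj v u → u = a ∨ u = b := fun u hu h =>
        hv u (hne _ _ h).symm (Or.inl hu) (Or.inl h)
      have f2 : ∀ c ∈ ({t, w', x, w} : Set V), G.Adj v c → x = a ∨ x = b := fun c hc h =>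
        hv x hvx.symm (Or.inr rfl) (Or.inr (Or.inr ⟨rfl, c, hc, h⟩))
      simp only [Set.mem_insert_iff, Set.mem_singleton_iff, not_or] at f1 f2 hvS
      clear hcon triangle diamond ih hlow hv
      obtain rfl : v = s := by
        obtain ⟨u, hu⟩ := low_def v hvx a b
        grind
      have f3 := f2 t (by simp) hts.symm
      have hvw : ¬ G.Adj v w := by grind
      have hvw' : ¬ G.Adj v w' := by grind
      refine ⟨?_, if x = a then b else a, by grind⟩
      by_contra h
      obtain ⟨u, hu⟩ := low_def v hvx t (if x = a then b else a)
      have hux : u ≠ x := fun h' => h (h' ▸ hu.1)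
      have huw : u ≠ w := fun h' => hvw (h' ▸ hu.1)
      have huw' : u ≠ w' := fun h' => hvw' (h' ▸ hu.1)
      have f5 := f1 u ⟨hu.2.1, huw', hux, huw⟩ hu.1
      clear low_def hsymm hne hw f1 f2 hw'
      grind
    obtain ⟨hsx', u, hsN⟩ := hu
    -- The diamond on `s`, `v` makes `v` adjacent to `t`, hence equal to `w` or `w'`; but neither of
    -- these is adjacent to `s`.
    obtain ⟨v, t'', hxv, hvs, h1, h2, h3, h4⟩ := triangle s hsx'.symm
    clear hcon triangle ih hlow
    have hvt : t ≠ v := fun h => hxt (h ▸ hxv)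
    have hsv : ∀ u, G.Adj s u → u = x ∨ u = v ∨ u = t := by
      clear diamond
      grind
    have := diamond s v t t'' hsx'.symm hxv hvs.symm hts.symm h3 htx hvt h1 h2 hsv h4
    clear diamond
    grind
  -- An isolated `x` can be deleted, and `y` takes over as the excluded vertex.
  · have hlt : Nat.card {v // v ≠ x} < n := by
      rw [← hn]
      exact Finite.card_subtype_lt (x := x) (by simp)
    push Not at hiso
    obtain ⟨y', hyy', hy'x, -⟩ := low_def y hyx x y
    obtain ⟨v, hvy, a, b, hab⟩ := ih _ hlt (G.comap Subtype.val) rfl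
      (fun h => hG (h.trans (isMinor_of_injective _ Subtype.val_injective fun _ _ h => h)))
      ⟨y, hyx⟩ ⟨y', hy'x⟩ (fun h => hne _ _ hyy' (congrArg Subtype.val h).symm)
    refine hlow v v.2 ⟨a, b, fun w hw => ?_⟩
    rcases hab ⟨w, fun h => hiso v (h ▸ hw.symm)⟩ hw with h | h
    · exact Or.inl (congrArg Subtype.val h)
    · exact Or.inr (congrArg Subtype.val h)

theorem exists_low {V : Type*} [Finite V] [Nonempty V] (G : SimpleGraph V)
    (hG : ¬ IsMinor (completeGraph (Fin 4)) G) : ∃ v, Low G v := by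
  obtain ⟨x⟩ := ‹Nonempty V›
  by_cases h : ∃ y, y ≠ x
  · obtain ⟨y, hy⟩ := h
    obtain ⟨v, -, hv⟩ := exists_low_ne G rfl hG x y hy
    exact ⟨v, hv⟩
  · push Not at h
    exact ⟨x, x, x, fun w _ => Or.inl (h w)⟩

end HomBounds

/-! ### Odd-girth five and homomorphisms to `C8pp` -/

namespace HomBounds
open SimpleGraph

theorem five_le_oddGirth_iff {V : Type*} (G : SimpleGraph V) :
    5 ≤ oddGirth G ↔ ∀ a b c, G.Adj a b → G.Adj b c → ¬ G.Adj a c := by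
  constructor
  · intro h a b c hab hbc hac
    let w : G.Walk a a := Walk.cons hab (Walk.cons hbc (Walk.cons hac.symm Walk.nil))
    have hw : w.IsCycle := by
      have h1 := hab.ne
      have h2 := hbc.ne
      have h3 := hac.ne
      simp [w, Walk.isCycle_def, Walk.isTrail_def]
      grind
    have : oddGirth G ≤ 3 :=
      (iInf_le _ a).trans ((iInf_le _ w).trans (iInf_le _ ⟨hw, by simp [w]; decide⟩))
    exact absurd (h.trans this) (by decide)
  · intro h
    refine le_iInf fun a => le_iInf fun w => le_iInf fun ⟨hw, hodd⟩ => ?_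
    by_contra hlt
    have h5 : w.length < 5 := by exact_mod_cast not_le.1 hlt
    have h3 := hw.three_le_length
    have hlen : w.length = 3 := by
      obtain ⟨k, hk⟩ := hodd
      omega
    obtain ⟨s, hs⟩ := is3Clique_iff_exists_cycle_length_three.2 ⟨a, w, hw, hlen⟩
    classical
    obtain ⟨a, b, c, hab, hac, hbc, -⟩ := is3Clique_iff.1 hs
    exact h a b c hab hbc hac

theorem C8pp_adj (a b : Fin 8) : C8pp.Adj a b ↔
    a - b = 1 ∨ b - a = 1 ∨ s(a, b) = s(0, 4) ∨ s(a, b) = s(2, 6) := by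
  simp only [C8pp, sup_adj, cycleGraph_adj, edge_adj, Sym2.eq_iff]
  revert a b
  decide

instance : DecidableRel C8pp.Adj := fun a b => decidable_of_iff _ (C8pp_adj a b).symm

theorem oddGirth_C8pp : oddGirth C8pp = 5 := by
  refine le_antisymm ?_ ((five_le_oddGirth_iff _).2 (by decide))
  have h01 : C8pp.Adj 0 1 := by decide
  have h12 : C8pp.Adj 1 2 := by decide
  have h23 : C8pp.Adj 2 3 := by decide
  have h34 : C8pp.Adj 3 4 := by decide
  have h40 : C8pp.Adj 4 0 := by decide
  let w : C8pp.Walk 0 0 :=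
    Walk.cons h01 (Walk.cons h12 (Walk.cons h23 (Walk.cons h34 (Walk.cons h40 Walk.nil))))
  have hw : w.IsCycle := by
    simp [w, Walk.isCycle_def, Walk.isTrail_def]
  exact (iInf_le _ 0).trans ((iInf_le _ w).trans (iInf_le _ ⟨hw, by simp [w]; decide⟩))

theorem ncard_edgeSet_C8pp : C8pp.edgeSet.ncard = 10 := by
  rw [← coe_edgeFinset, Set.ncard_coe_finset]
  decide

/-- The two relations used to colour mixed graphs: adjacency, and being at distance two. -/
def rel (p : Bool) (i j : Fin 8) : Prop :=
  if p then C8pp.Adj i j else i ≠ j ∧ ¬ C8pp.Adj i j ∧ s(i, j) ≠ s(1, 5) ∧ s(i, j) ≠ s(3, 7)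

instance (p : Bool) (i j : Fin 8) : Decidable (rel p i j) := by
  unfold rel
  infer_instance

theorem rel_symm : ∀ p i j, rel p i j → rel p j i := by
  decide

/-- Pairs `{1, 5}` and `{3, 7}` have no common neighbour, which `q = r = true` would demand; this is
why `rel false` leaves them out. -/
theorem rel_extend : ∀ p q r, (p && q && r) = false → ∀ i j, rel p i j →
    ∃ k, rel q k i ∧ rel r k j := by
  decide

theorem rel_exists : ∀ p i, ∃ k, rel p k i := by
  decide

-- For `A = H` this is a homomorphism to `C8pp`. The general form survives contraction: the edge
-- `ab` created by removing `v` is non-unit unless `ab` was already in `A`, so `A` stays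
-- triangle-free, which is exactly the condition for colouring `v` afterwards.
open Classical in
theorem exists_mixed_coloring {n : ℕ} : ∀ {V : Type*} [Finite V] (H A : SimpleGraph V),
    Nat.card V = n → ¬ IsMinor (completeGraph (Fin 4)) H → A ≤ H →
    (∀ a b c, A.Adj a b → A.Adj b c → ¬ A.Adj a c) →
    ∃ f : V → Fin 8, ∀ u v, H.Adj u v → rel (decide (A.Adj u v)) (f u) (f v) := by
  induction n using Nat.strong_induction_on with
  | _ n ih =>
  intro V _ H A hn hH hA htri
  rcases isEmpty_or_nonempty V with hV | hV
  · exact ⟨fun v => 0, fun u => hV.elim u⟩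
  obtain ⟨v, a, b, hab⟩ := exists_low H hH
  -- it suffices to colour the rest, compatibly with the neighbours of `v`
  have extend : ∀ (f : V → Fin 8) (c : Fin 8),
      (∀ u w, u ≠ v → w ≠ v → H.Adj u w → rel (decide (A.Adj u w)) (f u) (f w)) →
      (∀ w, H.Adj v w → rel (decide (A.Adj v w)) c (f w)) →
      ∃ f : V → Fin 8, ∀ u v, H.Adj u v → rel (decide (A.Adj u v)) (f u) (f v) := by
    intro f c hf hc
    refine ⟨Function.update f v c, fun u w huw => ?_⟩
    by_cases hu : u = v
    · subst hu
      rw [Function.update_self, Function.update_of_ne huw.ne']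
      exact hc w huw
    · by_cases hw : w = v
      · subst hw
        rw [Function.update_self, Function.update_of_ne hu]
        have := rel_symm _ _ _ (hc u huw.symm)
        rwa [A.adj_comm] at this
      · rw [Function.update_of_ne hu, Function.update_of_ne hw]
        exact hf u w hu hw huw
  by_cases hiso : ∃ a, H.Adj v a
  -- The witnesses of `Low` need not be neighbours; `a` is arranged to be one, since an edge is to
  -- be contracted.
  · obtain ⟨a, b, hva, hab⟩ : ∃ a b, H.Adj v a ∧ ∀ w, H.Adj v w → w = a ∨ w = b := by
      obtain ⟨c, hc⟩ := hiso
      rcases hab c hc with h | h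
      · exact ⟨a, b, h ▸ hc, hab⟩
      · exact ⟨b, a, h ▸ hc, fun w hw => (hab w hw).symm⟩
    have hav := hva.ne
    have hlt : Nat.card {u // u ∉ ({v, a} : Set V) ∨ u = a} < n := by
      rw [← hn]
      exact Finite.card_subtype_lt (x := v) (by simp [hav])
    have hmem : ∀ u, u ≠ v → u ∉ ({v, a} : Set V) ∨ u = a := fun u hu => by
      by_cases h : u = a
      · exact Or.inr h
      · exact Or.inl (by simp [hu, h])
    obtain ⟨f, hf⟩ := ih _ hlt (contract H {v, a} a) (A.comap Subtype.val) rfl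
      (fun h => hH (h.trans (contract_isMinor (by simp) (induce_pair_connected_of_adj hva))))
      (fun x y hxy => ⟨hxy.ne, Or.inl (hA hxy)⟩) (fun x y z => htri x y z)
    have hf' : ∀ x y, (contract H {v, a} a).Adj x y →
        rel (decide (A.Adj x y)) (f x) (f y) := fun x y hxy => by
      simpa only [comap_adj] using hf x y hxy
    set g : V → Fin 8 := fun u => if h : u ≠ v then f ⟨u, hmem u h⟩ else 0
    have hg : ∀ u (h : u ≠ v), g u = f ⟨u, hmem u h⟩ := fun u h => dif_pos h
    have hgf : ∀ u w, u ≠ v → w ≠ v → H.Adj u w → rel (decide (A.Adj u w)) (g u) (g w) := by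
      intro u w hu hw huw
      rw [hg u hu, hg w hw]
      exact hf' ⟨u, hmem u hu⟩ ⟨w, hmem w hw⟩
        ⟨fun h => huw.ne (congrArg Subtype.val h), Or.inl huw⟩
    by_cases hvb : H.Adj v b ∧ a ≠ b
    · obtain ⟨hvb, hne⟩ := hvb
      have hrel : rel (decide (A.Adj a b)) (g a) (g b) := by
        rw [hg a hav.symm, hg b hvb.ne']
        exact hf' ⟨a, hmem a hav.symm⟩ ⟨b, hmem b hvb.ne'⟩
          ⟨fun h => hne (congrArg Subtype.val h), Or.inr (Or.inl ⟨rfl, v, by simp, hvb⟩)⟩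
      obtain ⟨c, hca, hcb⟩ := rel_extend _ (decide (A.Adj v a)) (decide (A.Adj v b)) (by
        rw [Bool.eq_false_iff]
        intro h
        simp only [Bool.and_eq_true, decide_eq_true_eq] at h
        exact htri v a b h.1.2 h.1.1 h.2) _ _ hrel
      exact extend g c hgf fun w hw => by rcases hab w hw with rfl | rfl <;> assumption
    · obtain ⟨c, hc⟩ := rel_exists (decide (A.Adj v a)) (g a)
      refine extend g c hgf fun w hw => ?_
      obtain rfl : w = a := by grind
      exact hc
  · push Not at hiso
    have hlt : Nat.card {u // u ≠ v} < n := by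
      rw [← hn]
      exact Finite.card_subtype_lt (x := v) (by simp)
    obtain ⟨f, hf⟩ := ih _ hlt (H.comap Subtype.val) (A.comap Subtype.val) rfl
      (fun h => hH (h.trans (isMinor_of_injective _ Subtype.val_injective fun _ _ h => h)))
      (fun x y hxy => hA hxy) (fun x y z => htri x y z)
    refine extend (fun u => if h : u ≠ v then f ⟨u, h⟩ else 0) 0 (fun u w hu hw huw => ?_)
      fun w hw => absurd hw (hiso w)
    rw [dif_pos hu, dif_pos hw]
    simpa only [comap_adj] using hf ⟨u, hu⟩ ⟨w, hw⟩ huw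

theorem boundsSP_C8pp : BoundsSP 5 C8pp := by
  classical
  intro V _ G ⟨hG, hg⟩
  obtain ⟨f, hf⟩ := exists_mixed_coloring G G rfl hG le_rfl ((five_le_oddGirth_iff G).1 hg)
  refine ⟨⟨f, fun {u v} huv => ?_⟩⟩
  have := hf u v huv
  simpa [rel, huv] using this

end HomBounds

/-! ### The universal weighted 2-tree and the relations it forces -/

namespace HomBounds
open SimpleGraph

/-- A finite graph in which the neighbours of rank at most that of `v` form a clique of size at
most two, for each vertex `v`, has no `K₄` minor. -/
theorem not_isMinor_four_of_rank {X : Type*} [Finite X] (H : SimpleGraph X) (ρ : X → ℕ)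
    (h1 : ∀ v x y, H.Adj v x → H.Adj v y → ρ x ≤ ρ v → ρ y ≤ ρ v → x ≠ y → H.Adj x y)
    (h2 : ∀ v x y z, H.Adj v x → H.Adj v y → H.Adj v z → ρ x ≤ ρ v → ρ y ≤ ρ v → ρ z ≤ ρ v →
      x = y ∨ x = z ∨ y = z) :
    ¬ IsMinor (completeGraph (Fin 4)) H := by
  classical
  suffices key : ∀ n, ∀ S : Fin 4 → Set X, (∀ u, (H.induce (S u)).Connected) →
      (∀ u v, u ≠ v → Disjoint (S u) (S v)) →
      (∀ u v, u ≠ v → ∃ x ∈ S u, ∃ y ∈ S v, H.Adj x y) → (⋃ u, S u).ncard = n → False by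
    rintro ⟨S, hS, hd, ha⟩
    exact key _ S hS hd ha rfl
  intro n
  induction n using Nat.strong_induction_on with
  | _ n ih =>
  intro S hS hd ha hn
  have hdis : ∀ u u' x, x ∈ S u → x ∈ S u' → u = u' := fun u u' x hx hx' => by
    by_contra h
    exact Set.disjoint_left.1 (hd u u' h) hx hx'
  have hne : (⋃ u, S u).Nonempty := by
    obtain ⟨x⟩ := (hS 0).nonempty
    exact ⟨x, Set.mem_iUnion.2 ⟨0, x.2⟩⟩
  obtain ⟨v, hv, hmax⟩ := Set.exists_max_image (⋃ u, S u) ρ (Set.toFinite _) hne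
  obtain ⟨u, hvu⟩ := Set.mem_iUnion.1 hv
  have hle : ∀ t x, x ∈ S t → ρ x ≤ ρ v := fun t x hx => hmax x (Set.mem_iUnion.2 ⟨t, hx⟩)
  -- The vertex `v` of maximal rank can be dropped from a larger branch set, since its neighbours in
  -- the union form a clique. If it is a branch set alone, it needs three distinct neighbours there.
  by_cases hsing : ∃ x ∈ S u, x ≠ v
  · obtain ⟨x₀, hx₀, hxv₀⟩ := hsing
    obtain ⟨z, hz, hvz⟩ : ∃ z ∈ S u, H.Adj v z := by
      obtain ⟨w⟩ := (hS u).preconnected ⟨v, hvu⟩ ⟨x₀, hx₀⟩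
      cases w with
      | nil => exact absurd rfl hxv₀
      | @cons _ b _ hadj _ => exact ⟨b, b.2, hadj⟩
    refine ih (⋃ t, S t \ {v}).ncard ?_ (fun t => S t \ {v}) (fun t => ?_)
      (fun t t' htt' => (hd t t' htt').mono Set.sdiff_subset Set.sdiff_subset)
      (fun t t' htt' => ?_) rfl
    · rw [← hn]
      refine Set.ncard_lt_ncard ⟨Set.iUnion_mono fun t => Set.sdiff_subset, fun h => ?_⟩
      simpa using h hv
    · by_cases ht : t = u
      · subst ht
        -- A retraction sending `v` to its neighbour `z`; by the clique condition it maps edges to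
        -- edges or single vertices.
        let r : S t → (S t \ {v} : Set X) := fun w =>
          if h : (w : X) = v then ⟨z, hz, hvz.ne'⟩ else ⟨w, w.2, h⟩
        have hr : ∀ w (h : w ∈ S t \ {v}), r ⟨w, h.1⟩ = ⟨w, h⟩ := fun w h => dif_neg h.2
        have hz' : ∀ b (hb : b ∈ S t \ {v}), H.Adj v b →
            (H.induce (S t \ {v})).Reachable ⟨z, hz, hvz.ne'⟩ ⟨b, hb⟩ := fun b hb hvb => by
          by_cases hzb : z = b
          · subst hzb
            exact Reachable.refl _
          · exact Adj.reachable (G := H.induce (S t \ {v}))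
              (h1 v z b hvz hvb (hle t z hz) (hle t b hb.1) hzb)
        have hreach : ∀ a b : S t, (H.induce (S t)).Adj a b →
            (H.induce (S t \ {v})).Reachable (r a) (r b) := by
          rintro ⟨a, ha⟩ ⟨b, hb⟩ (hab : H.Adj a b)
          by_cases hav : a = v
          · subst hav
            rw [hr b ⟨hb, hab.ne'⟩, show r ⟨a, ha⟩ = ⟨z, hz, hvz.ne'⟩ from dif_pos rfl]
            exact hz' b _ hab
          · by_cases hbv : b = v
            · subst hbv
              rw [hr a ⟨ha, hab.ne⟩, show r ⟨b, hb⟩ = ⟨z, hz, hvz.ne'⟩ from dif_pos rfl]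
              exact (hz' a _ hab.symm).symm
            · rw [hr a ⟨ha, hav⟩, hr b ⟨hb, hbv⟩]
              exact Adj.reachable (G := H.induce (S t \ {v})) hab
        have : Nonempty (S t \ {v} : Set X) := ⟨⟨z, hz, hvz.ne'⟩⟩
        refine Connected.mk ?_
        rintro ⟨a, ha⟩ ⟨b, hb⟩
        have := reachable_map r hreach ((hS t).preconnected ⟨a, ha.1⟩ ⟨b, hb.1⟩)
        rwa [hr, hr] at this
      · have hvt : v ∉ S t := fun h => ht (hdis _ _ v h hvu)
        rw [Set.sdiff_singleton_eq_self hvt]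
        exact hS t
    · obtain ⟨x, hx, y, hy, hxy⟩ := ha t t' htt'
      have hzmem : z ∈ S u \ {v} := ⟨hz, hvz.ne'⟩
      by_cases hxv : x = v
      · subst hxv
        obtain rfl := hdis _ _ x hx hvu
        have hzy : z ≠ y := by
          rintro rfl
          exact htt' (hdis _ _ z hz hy)
        exact ⟨z, hzmem, y, ⟨hy, hxy.ne'⟩, h1 x z y hvz hxy (hle _ _ hz) (hle _ _ hy) hzy⟩
      · by_cases hyv : y = v
        · subst hyv
          obtain rfl := hdis _ _ y hy hvu
          have hxz : x ≠ z := by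
            rintro rfl
            exact htt' (hdis _ _ x hx hz)
          exact ⟨x, ⟨hx, hxv⟩, z, hzmem,
            h1 y x z hxy.symm hvz (hle _ _ hx) (hle _ _ hz) hxz⟩
        · exact ⟨x, ⟨hx, hxv⟩, y, ⟨hy, hyv⟩, hxy⟩
  · push Not at hsing
    have hnb : ∀ t, u ≠ t → ∃ y ∈ S t, H.Adj v y := fun t ht => by
      obtain ⟨x, hx, y, hy, hxy⟩ := ha u t ht
      exact ⟨y, hy, hsing x hx ▸ hxy⟩
    have hdist : ∀ u : Fin 4, u ≠ u + 1 ∧ u ≠ u + 2 ∧ u ≠ u + 3 ∧ u + 1 ≠ u + 2 ∧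
        u + 1 ≠ u + 3 ∧ u + 2 ≠ u + 3 := by decide
    obtain ⟨d1, d2, d3, d12, d13, d23⟩ := hdist u
    obtain ⟨x, hx, hvx⟩ := hnb _ d1
    obtain ⟨y, hy, hvy⟩ := hnb _ d2
    obtain ⟨z, hz, hvz⟩ := hnb _ d3
    rcases h2 v x y z hvx hvy hvz (hle _ _ hx) (hle _ _ hy) (hle _ _ hz) with rfl | rfl | rfl
    · exact d12 (hdis _ _ _ hx hy)
    · exact d13 (hdis _ _ _ hx hz)
    · exact d23 (hdis _ _ _ hy hz)

/-- Codes for the edges of the universal weighted 2-tree. The triangle attached to the edge `e`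
with weights `q`, `r` has the two new edges `(true, q, r) :: e` and `(false, q, r) :: e`. -/
abbrev Word := List (Bool × Bool × Bool)

/-- The vertices of the universal weighted 2-tree: the ends of the root edge, and the apices of
the triangles attached to the edges. -/
abbrev TreeVertex := Bool ⊕ (Word × Bool × Bool)

/-- The weight of an edge; `true` stands for distance one, `false` for distance two. A triangle
with three edges of weight `true` is never created. -/
def wt : Word → Bool
  | [] => true
  | (d, q, r) :: e => if d then q else r && !(wt e && q)

/-- The first end of an edge of the universal weighted 2-tree. -/
def src : Word → TreeVertex
  | [] => Sum.inl false
  | (d, q, r) :: e => if d then src e else Sum.inr (e, q, r)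

/-- The second end of an edge of the universal weighted 2-tree. -/
def tgt : Word → TreeVertex
  | [] => Sum.inl true
  | (d, q, r) :: e => if d then Sum.inr (e, q, r) else tgt e

/-- The stage at which a vertex is created. -/
def rank : TreeVertex → ℕ
  | Sum.inl b => if b then 1 else 0
  | Sum.inr (e, _, _) => e.length + 2

@[simp]
theorem rank_inl (b : Bool) : rank (Sum.inl b) = if b then 1 else 0 := rfl

@[simp]
theorem rank_inr (e : Word) (q r : Bool) : rank (Sum.inr (e, q, r)) = e.length + 2 := rfl

theorem rank_src_le (e : Word) : rank (src e) ≤ e.length + 1 := by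
  induction e with
  | nil => simp [src]
  | cons x e ih =>
    obtain ⟨d, q, r⟩ := x
    cases d
    · simp [src]
    · simp only [src, if_true, List.length_cons]
      omega

theorem rank_tgt_le (e : Word) : rank (tgt e) ≤ e.length + 1 := by
  induction e with
  | nil => simp [tgt]
  | cons x e ih =>
    obtain ⟨d, q, r⟩ := x
    cases d
    · simp only [tgt, List.length_cons, Bool.false_eq_true, if_false]
      omega
    · simp [tgt]

/-- `u` and `v` are the ends of an edge of weight `p`. -/
def Link (p : Bool) (u v : TreeVertex) : Prop :=
  ∃ e, wt e = p ∧ ((u = src e ∧ v = tgt e) ∨ (u = tgt e ∧ v = src e))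

theorem Link.symm {p : Bool} {u v : TreeVertex} (h : Link p u v) : Link p v u := by
  obtain ⟨e, he, h⟩ := h
  exact ⟨e, he, by tauto⟩

theorem link_self (e : Word) : Link (wt e) (src e) (tgt e) :=
  ⟨e, rfl, Or.inl ⟨rfl, rfl⟩⟩

theorem rank_src_ne (e : Word) : rank (src e) ≠ rank (tgt e) := by
  rcases e with _ | ⟨⟨d, q, r⟩, e⟩
  · simp [src, tgt]
  · have h1 := rank_src_le e
    have h2 := rank_tgt_le e
    cases d <;> simp [src, tgt] <;> omega

theorem Link.rank_ne {p : Bool} {u v : TreeVertex} (h : Link p u v) : rank u ≠ rank v := by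
  obtain ⟨e, -, ⟨rfl, rfl⟩ | ⟨rfl, rfl⟩⟩ := h
  · exact rank_src_ne e
  · exact (rank_src_ne e).symm

theorem Link.cases {p : Bool} {u v : TreeVertex} (h : Link p u v) (hr : rank v ≤ rank u) :
    (u = Sum.inl true ∧ v = Sum.inl false ∧ p = true) ∨
    ∃ e q r, u = Sum.inr (e, q, r) ∧
      ((v = src e ∧ p = q) ∨ (v = tgt e ∧ p = (r && !(wt e && q)))) := by
  have hlt : rank v < rank u := lt_of_le_of_ne hr h.rank_ne.symm
  obtain ⟨e, he, h⟩ := h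
  rcases e with _ | ⟨⟨d, q, r⟩, e⟩
  · left
    rcases h with ⟨rfl, rfl⟩ | ⟨rfl, rfl⟩
    · simp [src, tgt] at hlt
    · exact ⟨rfl, rfl, he.symm⟩
  · right
    have h1 := rank_src_le e
    have h2 := rank_tgt_le e
    refine ⟨e, q, r, ?_⟩
    cases d
    · rcases h with ⟨rfl, rfl⟩ | ⟨rfl, rfl⟩
      · exact ⟨rfl, Or.inr ⟨rfl, he.symm⟩⟩
      · simp [src, tgt] at hlt
        omega
    · rcases h with ⟨rfl, rfl⟩ | ⟨rfl, rfl⟩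
      · simp [src, tgt] at hlt
        omega
      · exact ⟨rfl, Or.inl ⟨rfl, he.symm⟩⟩

/-- Different words might conceivably link the same two vertices with different weights. The vertex
of higher rank records the triangle it was created in, which determines the weight. -/
theorem Link.eq_wt {p : Bool} {e : Word} (h : Link p (src e) (tgt e)) : p = wt e := by
  rcases e with _ | ⟨⟨d, q, r⟩, e⟩
  · rcases h.symm.cases (by simp [src, tgt]) with ⟨-, -, h⟩ | ⟨e, q, r, h, -⟩
    · exact h
    · simp [tgt] at h
  · have h1 := rank_src_le e
    have h2 := rank_tgt_le e
    have h3 := rank_src_ne e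
    cases d
    · rcases h.cases (by simp [src, tgt]; omega) with ⟨h, -, -⟩ | ⟨e', q', r', h, h'⟩
      · simp [src] at h
      · obtain ⟨rfl, rfl, rfl⟩ : e = e' ∧ q = q' ∧ r = r' := by simpa [src] using h
        rcases h' with ⟨h', -⟩ | ⟨-, h'⟩
        · exact absurd (congrArg rank h').symm h3
        · exact h'
    · rcases h.symm.cases (by simp [src, tgt]; omega) with ⟨h, -, -⟩ | ⟨e', q', r', h, h'⟩
      · simp [tgt] at h
      · obtain ⟨rfl, rfl, rfl⟩ : e = e' ∧ q = q' ∧ r = r' := by simpa [tgt] using h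
        rcases h' with ⟨-, h'⟩ | ⟨h', -⟩
        · exact h'
        · exact absurd (congrArg rank h') h3

/-- The universal weighted 2-tree, all weights included. -/
def fullTree : SimpleGraph TreeVertex where
  Adj u v := ∃ p, Link p u v
  symm := ⟨fun _ _ ⟨p, h⟩ => ⟨p, h.symm⟩⟩
  loopless := ⟨fun _ ⟨_, h⟩ => h.rank_ne rfl⟩

/-- The edges of weight `true` of the universal weighted 2-tree. -/
def unitTree : SimpleGraph TreeVertex where
  Adj u v := Link true u v
  symm := ⟨fun _ _ h => h.symm⟩
  loopless := ⟨fun _ h => h.rank_ne rfl⟩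

theorem fullTree_parents {v : TreeVertex} :
    (∃ x, ∀ w, fullTree.Adj v w → rank w ≤ rank v → w = x) ∨
    ∃ e, ∀ w, fullTree.Adj v w → rank w ≤ rank v → w = src e ∨ w = tgt e := by
  rcases v with b | ⟨e, q, r⟩
  · left
    refine ⟨Sum.inl false, fun w ⟨p, hw⟩ hr => ?_⟩
    rcases hw.cases hr with ⟨-, h, -⟩ | ⟨e, q, r, h, -⟩
    · exact h
    · simp at h
  · right
    refine ⟨e, fun w ⟨p, hw⟩ hr => ?_⟩
    rcases hw.cases hr with ⟨h, -⟩ | ⟨e', q', r', h, h'⟩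
    · simp at h
    · obtain ⟨rfl, rfl, rfl⟩ : e = e' ∧ q = q' ∧ r = r' := by simpa using h
      tauto

theorem not_isMinor_induce_fullTree {s : Set TreeVertex} (hs : s.Finite) :
    ¬ IsMinor (completeGraph (Fin 4)) (fullTree.induce s) := by
  have := hs.to_subtype
  refine not_isMinor_four_of_rank _ (fun v => rank v) ?_ ?_
  · rintro ⟨v, -⟩ ⟨x, hx⟩ ⟨y, hy⟩ (hvx : fullTree.Adj v x) (hvy : fullTree.Adj v y)
      (hrx : rank x ≤ rank v) (hry : rank y ≤ rank v) hne
    have hne' : x ≠ y := fun h => hne (Subtype.ext h)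
    show fullTree.Adj x y
    rcases fullTree_parents (v := v) with ⟨z, hz⟩ | ⟨e, he⟩
    · exact absurd ((hz x hvx hrx).trans (hz y hvy hry).symm) hne'
    · have hst : fullTree.Adj (src e) (tgt e) := ⟨_, link_self e⟩
      rcases he x hvx hrx with rfl | rfl <;> rcases he y hvy hry with rfl | rfl
      · exact absurd rfl hne'
      · exact hst
      · exact hst.symm
      · exact absurd rfl hne'
  · rintro ⟨v, -⟩ ⟨x, hx⟩ ⟨y, hy⟩ ⟨z, hz⟩ (hvx : fullTree.Adj v x) (hvy : fullTree.Adj v y)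
      (hvz : fullTree.Adj v z) (hrx : rank x ≤ rank v) (hry : rank y ≤ rank v)
      (hrz : rank z ≤ rank v)
    simp only [Subtype.mk.injEq]
    rcases fullTree_parents (v := v) with ⟨t, ht⟩ | ⟨e, he⟩
    · exact Or.inl ((ht x hvx hrx).trans (ht y hvy hry).symm)
    · have h1 := he x hvx hrx
      have h2 := he y hvy hry
      have h3 := he z hvz hrz
      grind

/-- The vertex of highest rank in such a triangle would be the apex over the edge joining the other
two, and `wt` turns the last side non-unit when the first two are unit. -/
theorem unitTree_triangle_free (a b c : TreeVertex) (hab : Link true a b) (hbc : Link true b c)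
    (hac : Link true a c) : False := by
  have key : ∀ u v w, Link true u v → Link true u w → Link true v w → rank v ≤ rank u →
      rank w ≤ rank u → False := by
    intro u v w huv huw hvw hv hw
    rcases huv.cases hv with ⟨rfl, rfl, -⟩ | ⟨e, q, r, rfl, h1⟩
    · rcases huw.cases hw with ⟨-, rfl, -⟩ | ⟨e, q, r, h, -⟩
      · exact hvw.rank_ne rfl
      · simp at h
    · rcases huw.cases hw with ⟨h, -, -⟩ | ⟨e', q', r', h, h2⟩
      · simp at h
      · obtain ⟨rfl, rfl, rfl⟩ : e = e' ∧ q = q' ∧ r = r' := by simpa using h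
        have hne := hvw.rank_ne
        rcases h1 with ⟨rfl, h1⟩ | ⟨rfl, h1⟩ <;> rcases h2 with ⟨rfl, h2⟩ | ⟨rfl, h2⟩
        · exact hne rfl
        · rw [← hvw.eq_wt, ← h1] at h2
          simp at h2
        · rw [← hvw.symm.eq_wt, ← h2] at h1
          simp at h1
        · exact hne rfl
  rcases le_total (rank a) (rank b) with h | h <;> rcases le_total (rank b) (rank c) with h' | h' <;>
    rcases le_total (rank a) (rank c) with h'' | h''
  · exact key c a b hac.symm hbc.symm hab h'' h'
  · exact key c a b hac.symm hbc.symm hab (h.trans h') h'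
  · exact key b a c hab.symm hbc hac h h'
  · exact key b a c hab.symm hbc hac h h'
  · exact key c a b hac.symm hbc.symm hab h'' h'
  · exact key a b c hab hac hbc h h''
  · exact key a b c hab hac hbc h (h'.trans h)
  · exact key a b c hab hac hbc h (h'.trans h)

/-- By compactness, as `W` is finite, finite subgraphs suffice. Non-unit edges only serve to show
that these have no `K₄` minor. -/
theorem exists_hom_unitTree {W : Type*} [Finite W] {B : SimpleGraph W} (hB : BoundsSP 5 B) :
    Nonempty (unitTree →g B) := by
  refine nonempty_hom_of_forall_finite_subgraph_hom fun G' hG' => Classical.choice ?_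
  have := hG'.to_subtype
  refine hB _ _ ⟨fun h => not_isMinor_induce_fullTree hG' (h.mono fun u v huv => ?_), ?_⟩
  · exact ⟨true, huv.adj_sub⟩
  · exact (five_le_oddGirth_iff _).2 fun a b c hab hbc hac =>
      unitTree_triangle_free a b c hab.adj_sub hbc.adj_sub hac.adj_sub

theorem exists_closed_relations {W : Type*} [Finite W] {B : SimpleGraph W} (hB : BoundsSP 5 B) :
    ∃ R : Bool → W → W → Prop, (∀ p a b, R p a b → R p b a) ∧
      (∀ a b, R true a b → B.Adj a b) ∧ (∃ a b, R true a b) ∧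
      ∀ p q r, (p && q && r) = false → ∀ a b, R p a b → ∃ c, R q a c ∧ R r c b := by
  obtain ⟨f⟩ := exists_hom_unitTree hB
  refine ⟨fun p a b => ∃ u v, Link p u v ∧ f u = a ∧ f v = b, ?_, ?_, ?_, ?_⟩
  · rintro p a b ⟨u, v, h, hu, hv⟩
    exact ⟨v, u, h.symm, hv, hu⟩
  · rintro a b ⟨u, v, h, rfl, rfl⟩
    exact f.map_rel h
  · exact ⟨_, _, _, _, link_self [], rfl, rfl⟩
  · rintro p q r hpqr _ _ ⟨u, v, ⟨e, rfl, h⟩, rfl, rfl⟩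
    have h1 : ∀ q r, Link q (src e) (Sum.inr (e, q, r)) := fun q r => link_self ((true, q, r) :: e)
    have h2 : ∀ q r, (wt e && q && r) = false → Link r (Sum.inr (e, q, r)) (tgt e) := by
      intro q r hqr
      have h := link_self ((false, q, r) :: e)
      have : wt ((false, q, r) :: e) = r := by
        simp only [wt, Bool.false_eq_true, if_false]
        cases r
        · rfl
        · rw [Bool.and_true] at hqr
          rw [hqr]
          rfl
      rwa [this] at h
    rcases h with ⟨rfl, rfl⟩ | ⟨rfl, rfl⟩
    · exact ⟨_, ⟨_, _, h1 q r, rfl, rfl⟩, ⟨_, _, h2 q r hpqr, rfl, rfl⟩⟩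
    -- The pair is traversed against the orientation of `e`, so `q` and `r` change places.
    · have hprq : (wt e && r && q) = false := by rwa [Bool.and_right_comm]
      exact ⟨_, ⟨_, _, (h2 r q hprq).symm, rfl, rfl⟩, ⟨_, _, (h1 r q).symm, rfl, rfl⟩⟩

end HomBounds

/-! ### Counting in closed pairs -/

namespace HomBounds
open SimpleGraph Finset

/-- A triangle-free graph `G` with a relation `D`, closed under all extensions of an edge or a
`D`-pair to a triangle, except for triangles of edges. -/
structure IsClosedPair {X : Type*} (G : SimpleGraph X) (D : X → X → Prop) : Prop where
  triangle_free : ∀ a b c, G.Adj a b → G.Adj b c → ¬ G.Adj a c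
  symm : ∀ a b, D a b → D b a
  exists_adj : ∀ a, ∃ b, G.Adj a b
  adj_left : ∀ a b, G.Adj a b → ∃ c, G.Adj a c ∧ D c b
  adj_none : ∀ a b, G.Adj a b → ∃ c, D a c ∧ D c b
  dist_both : ∀ a b, D a b → ∃ c, G.Adj a c ∧ G.Adj c b
  dist_left : ∀ a b, D a b → ∃ c, G.Adj a c ∧ D c b
  dist_none : ∀ a b, D a b → ∃ c, D a c ∧ D c b

namespace IsClosedPair

variable {X : Type*} {G : SimpleGraph X} {D : X → X → Prop}

theorem not_adj (h : IsClosedPair G D) {a b : X} (hab : D a b) : ¬ G.Adj a b := fun h' => by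
  obtain ⟨c, hac, hcb⟩ := h.dist_both a b hab
  exact h.triangle_free a c b hac hcb h'

theorem ne (h : IsClosedPair G D) {a b : X} (hab : D a b) : a ≠ b := by
  rintro rfl
  obtain ⟨c, hac, hca⟩ := h.dist_left a a hab
  exact h.not_adj hca hac.symm

/-- Within the `D`-neighbourhood of `a`, every vertex has both a `G`-neighbour and a `D`-neighbour.
Take `x`, a `G`-neighbour `y` of `x`, and `D`-neighbours `z`, `w` of `x`, `y`. If `z = w`, a
`G`-neighbour of `z` is the missing fourth vertex. -/
theorem exists_four (h : IsClosedPair G D) (a : X) : ∃ x y z w, D a x ∧ D a y ∧ D a z ∧ D a w ∧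
    x ≠ y ∧ x ≠ z ∧ x ≠ w ∧ y ≠ z ∧ y ≠ w ∧ z ≠ w := by
  have hE : ∀ x, D a x → ∃ y, D a y ∧ G.Adj x y := fun x hx => by
    obtain ⟨c, h1, h2⟩ := h.dist_left x a (h.symm _ _ hx)
    exact ⟨c, h.symm _ _ h2, h1⟩
  have hD : ∀ x, D a x → ∃ y, D a y ∧ D x y := fun x hx => by
    obtain ⟨c, h1, h2⟩ := h.dist_none a x hx
    exact ⟨c, h1, h.symm _ _ h2⟩
  obtain ⟨b, hb⟩ := h.exists_adj a
  obtain ⟨x, hx, -⟩ := h.adj_none a b hb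
  obtain ⟨y, hy, hxy⟩ := hE x hx
  obtain ⟨z, hz, hxz⟩ := hD x hx
  obtain ⟨w, hw, hyw⟩ := hD y hy
  have hyz : y ≠ z := fun h' => h.not_adj hxz (h' ▸ hxy)
  have hxw : x ≠ w := fun h' => h.not_adj hyw (h' ▸ hxy.symm)
  by_cases hzw : z = w
  · subst hzw
    obtain ⟨t, ht, hzt⟩ := hE z hz
    refine ⟨x, y, z, t, hx, hy, hz, ht, hxy.ne, h.ne hxz, ?_, hyz, ?_, hzt.ne⟩
    · rintro rfl
      exact h.not_adj hxz hzt.symm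
    · rintro rfl
      exact h.not_adj hyw hzt.symm
  · exact ⟨x, y, z, w, hx, hy, hz, hw, hxy.ne, h.ne hxz, hxw, hyz, h.ne hyw, hzw⟩

open Classical in
theorem four_le_card [Fintype X] (h : IsClosedPair G D) (a : X) (s : Finset X)
    (hs : ∀ x, D a x → x ∈ s) : 4 ≤ #s := by
  obtain ⟨x, y, z, w, hx, hy, hz, hw, h1, h2, h3, h4, h5, h6⟩ := h.exists_four a
  have hc : #({x, y, z, w} : Finset X) = 4 := by
    rw [card_insert_of_notMem, card_insert_of_notMem, card_insert_of_notMem, card_singleton] <;>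
      simp [h1, h2, h3, h4, h5, h6]
  rw [← hc]
  refine card_le_card fun v hv => ?_
  simp only [mem_insert, mem_singleton] at hv
  rcases hv with rfl | rfl | rfl | rfl
  exacts [hs _ hx, hs _ hy, hs _ hz, hs _ hw]

variable [Fintype X] [DecidableRel G.Adj]

theorem two_le_degree (h : IsClosedPair G D) (a : X) : 2 ≤ G.degree a := by
  obtain ⟨b, hb⟩ := h.exists_adj a
  obtain ⟨c, hc, hcb⟩ := h.adj_left a b hb
  rw [← card_neighborFinset_eq_degree]
  exact one_lt_card.2 ⟨c, by simpa using hc, b, by simpa using hb, h.ne hcb⟩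

open Classical in
theorem degree_add_five_le (h : IsClosedPair G D) (a : X) :
    G.degree a + 5 ≤ Fintype.card X := by
  have h4 := h.four_le_card a ((univ \ G.neighborFinset a).erase a) (fun x hx => by
    simp only [mem_erase, mem_sdiff, mem_univ, mem_neighborFinset, true_and]
    exact ⟨(h.ne hx).symm, h.not_adj hx⟩)
  rw [card_erase_of_mem (by simp), card_sdiff_of_subset (subset_univ _), card_univ,
    card_neighborFinset_eq_degree] at h4
  omega

/-- A neighbour of a vertex of degree two has degree at least three. -/
theorem three_le_degree (h : IsClosedPair G D) {a b : X} (hab : G.Adj a b)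
    (ha : G.degree a = 2) : 3 ≤ G.degree b := by
  classical
  by_contra hb
  have hb2 : G.degree b = 2 := by
    have := h.two_le_degree b
    omega
  have nbr : ∀ a b, G.Adj a b → G.degree a = 2 → ∃ c, ∀ x, G.Adj a x → x = b ∨ x = c := by
    intro a b hab ha
    rw [← card_neighborFinset_eq_degree, card_eq_two] at ha
    obtain ⟨x, y, -, hxy⟩ := ha
    have hN : ∀ z, G.Adj a z ↔ z = x ∨ z = y := fun z => by
      rw [← mem_neighborFinset, hxy]
      simp
    rcases (hN b).1 hab with rfl | rfl
    · exact ⟨y, fun z hz => (hN z).1 hz⟩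
    · exact ⟨x, fun z hz => ((hN z).1 hz).symm⟩
  obtain ⟨c, hc⟩ := nbr a b hab ha
  obtain ⟨b', hb'⟩ := nbr b a hab.symm hb2
  -- The `D`-neighbours of `a` are at distance two: they are `b'` or neighbours of `c`. The latter
  -- are independent, so each has `b'` as its only `G`-neighbour within the set. But one of them is
  -- in relation `D` with `b'`.
  have hcase : ∀ x, D a x → x = b' ∨ G.Adj c x := fun x hx => by
    obtain ⟨y, hay, hyx⟩ := h.dist_both a x hx
    rcases hc y hay with rfl | rfl
    · rcases hb' x hyx with rfl | rfl
      · exact absurd rfl (h.ne hx)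
      · exact Or.inl rfl
    · exact Or.inr hyx
  obtain ⟨x, hx, hxb⟩ : ∃ x, D a x ∧ x ≠ b' := by
    by_contra! hall
    have := h.four_le_card a {b'} fun x hx => by simpa using hall x hx
    simp at this
  obtain ⟨y, hxy, hya⟩ := h.dist_left x a (h.symm _ _ hx)
  have hcx := (hcase x hx).resolve_left hxb
  obtain rfl : y = b' := (hcase y (h.symm _ _ hya)).resolve_right
    fun hcy => h.triangle_free c x y hcx hxy hcy
  obtain ⟨z, haz, hzy⟩ := h.dist_none a y (h.symm _ _ hya)
  obtain ⟨t, hzt, hta⟩ := h.dist_left z a (h.symm _ _ haz)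
  have hcz := (hcase z haz).resolve_left (h.ne hzy)
  rcases hcase t (h.symm _ _ hta) with rfl | hct
  · exact h.not_adj hzy hzt
  · exact h.triangle_free c z t hcz hzt hct

/-- With at most seven vertices all degrees would be two, against `three_le_degree`. -/
theorem eight_le_card [Nonempty X] (h : IsClosedPair G D) : 8 ≤ Fintype.card X := by
  by_contra hlt
  have hdeg : ∀ a, G.degree a = 2 := fun a => by
    have := h.two_le_degree a
    have := h.degree_add_five_le a
    omega
  obtain ⟨a⟩ := ‹Nonempty X›
  obtain ⟨b, hab⟩ := h.exists_adj a
  have := h.three_le_degree hab (hdeg a)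
  have := hdeg b
  omega

/-- The vertices of degree two are independent, so that their degree sum is at most that of the
other vertices. -/
theorem sum_degree_two (h : IsClosedPair G D) :
    2 * #{a | G.degree a = 2} = ∑ b with ¬ G.degree b = 2, #{a | G.degree a = 2 ∧ G.Adj a b} := by
  classical
  have := sum_card_bipartiteAbove_eq_sum_card_bipartiteBelow (s := {a | G.degree a = 2})
    (t := {b | ¬ G.degree b = 2}) G.Adj
  calc 2 * #{a | G.degree a = 2} = ∑ a with G.degree a = 2, 2 := by
        rw [sum_const, smul_eq_mul, mul_comm]
    _ = ∑ a with G.degree a = 2, #(bipartiteAbove G.Adj {b | ¬ G.degree b = 2} a) := by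
        refine sum_congr rfl fun a ha => ?_
        have ha' : G.degree a = 2 := (mem_filter.1 ha).2
        refine ha'.symm.trans ?_
        rw [← card_neighborFinset_eq_degree]
        congr 1
        ext b
        simp only [mem_neighborFinset, mem_bipartiteAbove, mem_filter, mem_univ, true_and]
        refine ⟨fun hab => ⟨?_, hab⟩, fun hab => hab.2⟩
        have := h.three_le_degree hab ha'
        omega
    _ = _ := this
    _ = _ := by
        refine sum_congr rfl fun b _ => ?_
        congr 1
        ext a
        simp [mem_bipartiteBelow]

theorem card_le_degree (b : X) : #{a | G.degree a = 2 ∧ G.Adj a b} ≤ G.degree b := by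
  rw [← card_neighborFinset_eq_degree]
  exact card_le_card fun a ha => by simpa using (mem_filter.1 ha).2.2.symm

theorem degree_sum (G : SimpleGraph X) [DecidableRel G.Adj] : 2 * #{a | G.degree a = 2} +
    ∑ b with ¬ G.degree b = 2, G.degree b = 2 * G.edgeSet.ncard := by
  classical
  rw [← coe_edgeFinset, Set.ncard_coe_finset, ← G.sum_degrees_eq_twice_card_edges,
    ← sum_filter_add_sum_filter_not univ (fun a => G.degree a = 2)]
  congr 1
  rw [sum_congr rfl (fun a ha => (mem_filter.1 ha).2), sum_const, smul_eq_mul, mul_comm]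

theorem card_add_card (G : SimpleGraph X) [DecidableRel G.Adj] :
    #{a | G.degree a = 2} + #{b | ¬ G.degree b = 2} = Fintype.card X := by
  rw [card_filter_add_card_filter_not, card_univ]

theorem three_mul_le (h : IsClosedPair G D) :
    3 * #{b | ¬ G.degree b = 2} ≤ ∑ b with ¬ G.degree b = 2, G.degree b := by
  rw [mul_comm, ← smul_eq_mul, ← sum_const]
  refine sum_le_sum fun b hb => ?_
  have h1 := (mem_filter.1 hb).2
  have h2 := h.two_le_degree b
  omega

theorem two_mul_le (h : IsClosedPair G D) :
    2 * #{a | G.degree a = 2} ≤ ∑ b with ¬ G.degree b = 2, G.degree b := by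
  rw [h.sum_degree_two]
  exact sum_le_sum fun b _ => card_le_degree b

/-- Let `t` vertices have degree two, and let the other degrees sum to `σ`. Twice the size is `2t +
σ`, with `σ ≥ 2t` and `σ ≥ 3(8 - t)`: the first bound suffices for `t ≥ 5`, the second for `t ≤ 4`.
-/
theorem ten_le_ncard_edgeSet [Nonempty X] (h : IsClosedPair G D) : 10 ≤ G.edgeSet.ncard := by
  have h1 := h.eight_le_card
  have h2 := h.two_mul_le
  have h3 := h.three_mul_le
  have h4 := degree_sum G
  have h5 := card_add_card G
  omega

/-- A closed pair with `8` vertices and `10` edges has all degrees two and three, and both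
degrees occur. -/
theorem degree_le_three (h : IsClosedPair G D) (hX : Fintype.card X = 8)
    (hG : G.edgeSet.ncard = 10) : (∃ a, G.degree a = 2) ∧ ∀ a, G.degree a ≤ 3 := by
  classical
  have h2 := h.two_mul_le
  have h3 := h.three_mul_le
  have h4 := degree_sum G
  have h5 := card_add_card G
  have hT : ∃ a, G.degree a = 2 := by
    have : 0 < #{a | G.degree a = 2} := by omega
    obtain ⟨a, ha⟩ := card_pos.1 this
    exact ⟨a, (mem_filter.1 ha).2⟩
  refine ⟨hT, fun a => ?_⟩
  -- Counting leaves four or five vertices of degree two. With four, the other four have degree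
  -- three. With five, the edges all run between the two classes, so `D` cannot lead out of the
  -- degree-two class, contradicting `adj_none` on an edge.
  by_cases hcase : #{a | G.degree a = 2} = 4
  · by_cases ha : G.degree a = 2
    · omega
    · have heq : ∑ b with ¬ G.degree b = 2, 3 = ∑ b with ¬ G.degree b = 2, G.degree b := by
        rw [sum_const, smul_eq_mul]
        omega
      rw [sum_eq_sum_iff_of_le (fun b hb => by
        have h1 := (mem_filter.1 hb).2
        have h2 := h.two_le_degree b
        omega)] at heq
      exact (heq a (by simpa using ha)).ge
  · exfalso
    have heq : ∑ b with ¬ G.degree b = 2, #{a | G.degree a = 2 ∧ G.Adj a b} =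
        ∑ b with ¬ G.degree b = 2, G.degree b := by
      rw [← h.sum_degree_two]
      omega
    rw [sum_eq_sum_iff_of_le (fun b _ => card_le_degree b)] at heq
    have hbip : ∀ a b, G.Adj a b → ¬ G.degree b = 2 → G.degree a = 2 := by
      intro a b hab hb
      have h1 := heq b (by simpa using hb)
      rw [← card_neighborFinset_eq_degree] at h1
      have h2 := eq_of_subset_of_card_le (s := {a | G.degree a = 2 ∧ G.Adj a b})
        (t := G.neighborFinset b)
        (fun a ha => by simpa using (mem_filter.1 ha).2.2.symm) h1.ge
      have h3 : a ∈ G.neighborFinset b := by simpa using hab.symm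
      rw [← h2] at h3
      exact (mem_filter.1 h3).2.1
    have hD : ∀ x y, D x y → G.degree x = 2 → G.degree y = 2 := by
      intro x y hxy hx
      obtain ⟨c, hxc, hcy⟩ := h.dist_both x y hxy
      have := h.three_le_degree hxc hx
      exact hbip y c hcy.symm (by omega)
    obtain ⟨a, ha⟩ := hT
    obtain ⟨b, hab⟩ := h.exists_adj a
    obtain ⟨c, hac, hcb⟩ := h.adj_none a b hab
    have h1 := hD c b hcb (hD a c hac ha)
    have h2 := h.three_le_degree hab ha
    omega

end IsClosedPair
end HomBounds

/-! ### Closed pairs with eight vertices and ten edges -/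

namespace HomBounds
open SimpleGraph Finset

theorem C8pp_hom {X : Type*} {G : SimpleGraph X} (f : Fin 8 → X)
    (h : ∀ i, G.Adj (f i) (f (i + 1))) (h04 : G.Adj (f 0) (f 4)) (h26 : G.Adj (f 2) (f 6)) :
    ∀ i j, C8pp.Adj i j → G.Adj (f i) (f j) := by
  intro i j hij
  rw [C8pp_adj] at hij
  simp only [Sym2.eq_iff] at hij
  rcases hij with hij | hij | (⟨rfl, rfl⟩ | ⟨rfl, rfl⟩) | (⟨rfl, rfl⟩ | ⟨rfl, rfl⟩)
  · rw [sub_eq_iff_eq_add'] at hij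
    subst hij
    exact (h j).symm
  · rw [sub_eq_iff_eq_add'] at hij
    subst hij
    exact h i
  exacts [h04, h04.symm, h26, h26.symm]

namespace IsClosedPair

variable {X : Type*} {G : SimpleGraph X} {D : X → X → Prop} [Fintype X] [DecidableRel G.Adj]

/-- The neighbourhood of a vertex of degree two in a closed pair with maximum degree three. -/
theorem exists_two_paths (h : IsClosedPair G D) (hdeg : ∀ a, G.degree a ≤ 3) {a b c : X}
    (hN : ∀ x, G.Adj a x ↔ x = b ∨ x = c) (hbc : b ≠ c) :
    ∃ b₁ b₂ c₁ c₂, (∀ x, G.Adj b x ↔ x = a ∨ x = b₁ ∨ x = b₂) ∧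
      (∀ x, G.Adj c x ↔ x = a ∨ x = c₁ ∨ x = c₂) ∧ G.Adj b₁ c₁ ∧ G.Adj b₂ c₂ ∧
      [a, b, c, b₁, b₂, c₁, c₂].Nodup := by
  classical
  have hab : G.Adj a b := (hN b).2 (Or.inl rfl)
  have hac : G.Adj a c := (hN c).2 (Or.inr rfl)
  have nbr : ∀ b, G.Adj a b → ∃ x y, ∀ z, G.Adj b z → z = a ∨ z = x ∨ z = y := by
    intro b hab
    have ha : a ∈ G.neighborFinset b := by simpa using hab.symm
    have hc : #((G.neighborFinset b).erase a) ≤ 2 := by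
      rw [card_erase_of_mem ha, card_neighborFinset_eq_degree]
      have := hdeg b
      omega
    have hsub : ∃ x y, (G.neighborFinset b).erase a ⊆ {x, y} := by
      have h3 := h.two_le_degree b
      rw [← card_neighborFinset_eq_degree] at h3
      have h4 := card_erase_of_mem ha
      have : #((G.neighborFinset b).erase a) = 1 ∨ #((G.neighborFinset b).erase a) = 2 := by
        omega
      rcases this with h1 | h1
      · obtain ⟨x, hx⟩ := card_eq_one.1 h1
        exact ⟨x, x, by simp [hx]⟩
      · obtain ⟨x, y, -, hxy⟩ := card_eq_two.1 h1
        exact ⟨x, y, by rw [hxy]⟩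
    obtain ⟨x, y, hxy⟩ := hsub
    refine ⟨x, y, fun z hz => ?_⟩
    by_cases hza : z = a
    · exact Or.inl hza
    · have := hxy (mem_erase.2 ⟨hza, by simpa using hz⟩)
      simpa using Or.inr (a := z = a) this
  obtain ⟨b₁, b₂, hb⟩ := nbr b hab
  obtain ⟨c₁, c₂, hc⟩ := nbr c hac
  have hD : ∀ x, D a x → (x = b₁ ∨ x = b₂ ∨ x = c₁ ∨ x = c₂) ∧ (G.Adj b x ∨ G.Adj c x) := by
    intro x hx
    have hne := h.ne hx
    obtain ⟨y, hay, hyx⟩ := h.dist_both a x hx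
    rcases (hN y).1 hay with rfl | rfl
    · have := hb x hyx
      exact ⟨by grind, Or.inl hyx⟩
    · have := hc x hyx
      exact ⟨by grind, Or.inr hyx⟩
  -- the four second neighbours are exactly the vertices in relation `D` with `a`
  have key : ∀ s : Finset X, s ⊆ {b₁, b₂, c₁, c₂} → (∀ x, D a x → x ∈ s) →
      s = {b₁, b₂, c₁, c₂} ∧ #({b₁, b₂, c₁, c₂} : Finset X) = 4 := by
    intro s hs hDs
    have h4 := h.four_le_card a s hDs
    have h5 : #({b₁, b₂, c₁, c₂} : Finset X) ≤ 4 := card_le_four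
    have h6 := card_le_card hs
    exact ⟨eq_of_subset_of_card_le hs (by omega), by omega⟩
  obtain ⟨hM, hcard⟩ := key {x | D a x} (fun x hx => by
    simpa using (hD x (by simpa using hx)).1) (fun x hx => by simpa using hx)
  have hnodup : b₁ ≠ b₂ ∧ b₁ ≠ c₁ ∧ b₁ ≠ c₂ ∧ b₂ ≠ c₁ ∧ b₂ ≠ c₂ ∧ c₁ ≠ c₂ := by
    have h5 : ∀ x y z : X, #({x, y, z} : Finset X) < 4 := fun x y z =>
      lt_of_le_of_lt card_le_three (by norm_num)
    refine ⟨?_, ?_, ?_, ?_, ?_, ?_⟩ <;> rintro rfl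
    · exact (h5 b₁ c₁ c₂).ne (by rw [← hcard]; congr 1; grind)
    · exact (h5 b₁ b₂ c₂).ne (by rw [← hcard]; congr 1; grind)
    · exact (h5 b₁ b₂ c₁).ne (by rw [← hcard]; congr 1; grind)
    · exact (h5 b₁ b₂ c₂).ne (by rw [← hcard]; congr 1; grind)
    · exact (h5 b₁ b₂ c₁).ne (by rw [← hcard]; congr 1; grind)
    · exact (h5 b₁ b₂ c₁).ne (by rw [← hcard]; congr 1; grind)
  have hDM : ∀ x, D a x ↔ x = b₁ ∨ x = b₂ ∨ x = c₁ ∨ x = c₂ := fun x => by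
    have : x ∈ ({x | D a x} : Finset X) ↔ x ∈ ({b₁, b₂, c₁, c₂} : Finset X) := by rw [hM]
    simpa using this
  obtain ⟨n1, n2, n3, n4, n5, n6⟩ := hnodup
  have ha2 : G.degree a = 2 := by
    rw [← card_neighborFinset_eq_degree, ← card_pair hbc]
    congr 1
    ext x
    simp [hN]
  have full : ∀ b x y, G.Adj a b → (∀ z, G.Adj b z → z = a ∨ z = x ∨ z = y) →
      ∀ z, G.Adj b z ↔ z = a ∨ z = x ∨ z = y := by
    intro b x y hab hb z
    have h1 : G.neighborFinset b ⊆ {a, x, y} := fun z hz => by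
      simpa using hb z (by simpa using hz)
    have h2 := h.three_le_degree hab ha2
    rw [← card_neighborFinset_eq_degree] at h2
    have h3 := eq_of_subset_of_card_le h1 (card_le_three.trans h2)
    rw [← mem_neighborFinset, h3]
    simp
  have hb' := full b b₁ b₂ hab hb
  have hc' := full c c₁ c₂ hac hc
  have hnd : ∀ x, D a x → a ≠ x ∧ b ≠ x ∧ c ≠ x := fun x hx =>
    ⟨h.ne hx, fun hbx => h.not_adj hx (hbx ▸ hab), fun hcx => h.not_adj hx (hcx ▸ hac)⟩
  have hb₁ := hnd b₁ ((hDM _).2 (by simp))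
  have hb₂ := hnd b₂ ((hDM _).2 (by simp))
  have hc₁ := hnd c₁ ((hDM _).2 (by simp))
  have hc₂ := hnd c₂ ((hDM _).2 (by simp))
  have hE : ∀ x, D a x → ∃ y, D a y ∧ G.Adj x y := fun x hx => by
    obtain ⟨y, h1, h2⟩ := h.dist_left x a (h.symm _ _ hx)
    exact ⟨y, h.symm _ _ h2, h1⟩
  have hbi : ∀ x y, G.Adj b x → G.Adj b y → ¬ G.Adj x y := fun x y hx hy hxy =>
    h.triangle_free b x y hx hxy hy
  have hci : ∀ x y, G.Adj c x → G.Adj c y → ¬ G.Adj x y := fun x y hx hy hxy =>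
    h.triangle_free c x y hx hxy hy
  have hEb : ∀ x, x = b₁ ∨ x = b₂ → G.Adj x c₁ ∨ G.Adj x c₂ := fun x hx => by
    have hbx : G.Adj b x := (hb' x).2 (Or.inr hx)
    obtain ⟨y, hy, hxy⟩ := hE x ((hDM x).2 (by tauto))
    rcases (hDM y).1 hy with rfl | rfl | rfl | rfl
    · exact absurd hxy (hbi _ _ hbx ((hb' _).2 (by simp)))
    · exact absurd hxy (hbi _ _ hbx ((hb' _).2 (by simp)))
    · exact Or.inl hxy
    · exact Or.inr hxy
  have hEc : ∀ x, x = c₁ ∨ x = c₂ → G.Adj b₁ x ∨ G.Adj b₂ x := fun x hx => by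
    have hcx : G.Adj c x := (hc' x).2 (Or.inr hx)
    obtain ⟨y, hy, hxy⟩ := hE x ((hDM x).2 (by tauto))
    rcases (hDM y).1 hy with rfl | rfl | rfl | rfl
    · exact Or.inl hxy.symm
    · exact Or.inr hxy.symm
    · exact absurd hxy (hci _ _ hcx ((hc' _).2 (by simp)))
    · exact absurd hxy (hci _ _ hcx ((hc' _).2 (by simp)))
  -- A bipartite graph with two vertices on each side and none isolated has a perfect matching.
  have hmatch : (G.Adj b₁ c₁ ∧ G.Adj b₂ c₂) ∨ (G.Adj b₁ c₂ ∧ G.Adj b₂ c₁) := by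
    have e1 := hEb b₁ (by simp)
    have e2 := hEb b₂ (by simp)
    have e3 := hEc c₁ (by simp)
    have e4 := hEc c₂ (by simp)
    tauto
  have hne := hab.ne
  have hne' := hac.ne
  rcases hmatch with ⟨m1, m2⟩ | ⟨m1, m2⟩
  · refine ⟨b₁, b₂, c₁, c₂, hb', hc', m1, m2, ?_⟩
    simp only [List.nodup_cons, List.mem_cons, List.not_mem_nil, not_or, or_false,
      not_false_eq_true, List.nodup_nil, and_true]
    exact ⟨⟨hne, hne', hb₁.1, hb₂.1, hc₁.1, hc₂.1⟩, ⟨hbc, hb₁.2.1, hb₂.2.1, hc₁.2.1, hc₂.2.1⟩,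
      ⟨hb₁.2.2, hb₂.2.2, hc₁.2.2, hc₂.2.2⟩, ⟨n1, n2, n3⟩, ⟨n4, n5⟩, n6⟩
  · refine ⟨b₁, b₂, c₂, c₁, hb', fun x => by rw [hc', or_comm (a := x = c₁)], m1, m2, ?_⟩
    simp only [List.nodup_cons, List.mem_cons, List.not_mem_nil, not_or, or_false,
      not_false_eq_true, List.nodup_nil, and_true]
    exact ⟨⟨hne, hne', hb₁.1, hb₂.1, hc₂.1, hc₁.1⟩, ⟨hbc, hb₁.2.1, hb₂.2.1, hc₂.2.1, hc₁.2.1⟩,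
      ⟨hb₁.2.2, hb₂.2.2, hc₂.2.2, hc₁.2.2⟩, ⟨n1, n3, n2⟩, ⟨n5, n4⟩, n6.symm⟩

/-- The degree bound leaves `b₁` and `b₂` no neighbours beyond `b`, `w` and their partners, so `w`
would have at most the three `D`-neighbours `b`, `c₁`, `c₂`. Applied to the eighth vertex, this
excludes two neighbours on the same side. -/
theorem nonadj_matched (h : IsClosedPair G D) (hdeg : ∀ a, G.degree a ≤ 3)
    {b b₁ b₂ c₁ c₂ w : X} (hb₁ : G.Adj b₁ b) (hb₂ : G.Adj b₂ b) (hc₁ : G.Adj b₁ c₁)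
    (hc₂ : G.Adj b₂ c₂) (hw₁ : G.Adj w b₁) (hw₂ : G.Adj w b₂)
    (hw : ∀ x, G.Adj w x → x = b₁ ∨ x = b₂ ∨ x = c₁ ∨ x = c₂)
    (hbc₁ : b ≠ c₁) (hbc₂ : b ≠ c₂) (hwb : w ≠ b) (hwc₁ : w ≠ c₁) (hwc₂ : w ≠ c₂) : False := by
  classical
  have full : ∀ p x y z, G.Adj p x → G.Adj p y → G.Adj p z → x ≠ y → x ≠ z → y ≠ z →
      ∀ t, G.Adj p t → t = x ∨ t = y ∨ t = z := by
    intro p x y z hx hy hz hxy hxz hyz t ht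
    have h1 : ({x, y, z} : Finset X) ⊆ G.neighborFinset p := fun t ht => by
      simp only [mem_insert, mem_singleton] at ht
      rcases ht with rfl | rfl | rfl <;> simpa
    have h2 : #({x, y, z} : Finset X) = 3 := card_eq_three.2 ⟨x, y, z, hxy, hxz, hyz, rfl⟩
    have h3 := eq_of_subset_of_card_le h1 (by
      rw [h2, card_neighborFinset_eq_degree]
      exact hdeg p)
    have h4 : t ∈ G.neighborFinset p := by simpa using ht
    rw [← h3] at h4
    simpa using h4
  have h1 := full b₁ b c₁ w hb₁ hc₁ hw₁.symm hbc₁ hwb.symm hwc₁.symm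
  have h2 := full b₂ b c₂ w hb₂ hc₂ hw₂.symm hbc₂ hwb.symm hwc₂.symm
  have := h.four_le_card w {b, c₁, c₂} fun x hx => by
    have hne := h.ne hx
    obtain ⟨y, hwy, hyx⟩ := h.dist_both w x hx
    rcases hw y hwy with rfl | rfl | rfl | rfl
    · have := h1 x hyx
      simp only [mem_insert, mem_singleton]
      grind
    · have := h2 x hyx
      simp only [mem_insert, mem_singleton]
      grind
    · exact absurd hwy (h.triangle_free _ _ _ hw₁ hc₁)
    · exact absurd hwy (h.triangle_free _ _ _ hw₂ hc₂)
  have h3 : #({b, c₁, c₂} : Finset X) ≤ 3 := card_le_three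
  omega

/-- A closed pair with `8` vertices and `10` edges contains a spanning copy of `C₈⁺⁺`. -/
theorem exists_C8pp (h : IsClosedPair G D) (hX : Fintype.card X = 8)
    (hG : G.edgeSet.ncard = 10) : ∃ f : Fin 8 → X, Function.Injective f ∧
      ∀ i j, C8pp.Adj i j → G.Adj (f i) (f j) := by
  classical
  obtain ⟨⟨a, ha⟩, hdeg⟩ := h.degree_le_three hX hG
  obtain ⟨b, c, hbc, hN⟩ : ∃ b c, b ≠ c ∧ ∀ x, G.Adj a x ↔ x = b ∨ x = c := by
    rw [← card_neighborFinset_eq_degree, card_eq_two] at ha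
    obtain ⟨x, y, hne, hxy⟩ := ha
    exact ⟨x, y, hne, fun z => by rw [← mem_neighborFinset, hxy]; simp⟩
  obtain ⟨b₁, b₂, c₁, c₂, hb, hc, m1, m2, hnd⟩ := h.exists_two_paths hdeg hN hbc
  obtain ⟨w, hw⟩ : ∃ w, w ∉ [a, b, c, b₁, b₂, c₁, c₂].toFinset := by
    by_contra! hall
    have h1 := card_le_card (s := univ) (t := [a, b, c, b₁, b₂, c₁, c₂].toFinset)
      fun x _ => hall x
    rw [card_univ, hX, List.toFinset_card_of_nodup hnd] at h1
    simp at h1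
  have hnd' : (w :: [a, b, c, b₁, b₂, c₁, c₂]).Nodup :=
    List.nodup_cons.2 ⟨fun h => hw (List.mem_toFinset.2 h), hnd⟩
  have hall : ∀ x, x ∈ w :: [a, b, c, b₁, b₂, c₁, c₂] := fun x => by
    have h1 : (w :: [a, b, c, b₁, b₂, c₁, c₂]).toFinset = univ := by
      rw [← card_eq_iff_eq_univ, List.toFinset_card_of_nodup hnd', hX]
      rfl
    rw [← List.mem_toFinset, h1]
    exact mem_univ x
  have hab : G.Adj a b := (hN b).2 (Or.inl rfl)
  have hac : G.Adj a c := (hN c).2 (Or.inr rfl)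
  have hbb₁ : G.Adj b b₁ := (hb _).2 (by simp)
  have hbb₂ : G.Adj b b₂ := (hb _).2 (by simp)
  have hcc₁ : G.Adj c c₁ := (hc _).2 (by simp)
  have hcc₂ : G.Adj c c₂ := (hc _).2 (by simp)
  simp only [List.nodup_cons, List.mem_cons, List.not_mem_nil, not_or, or_false,
    not_false_eq_true, List.nodup_nil, and_true] at hnd' hall
  obtain ⟨⟨w1, w2, w3, w4, w5, w6, w7⟩, ⟨a1, a2, a3, a4, a5, a6⟩, ⟨b1, b2, b3, b4, b5⟩,
    ⟨c1, c2, c3, c4⟩, ⟨d1, d2, d3⟩, ⟨e1, e2⟩, f1⟩ := hnd'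
  have hwN : ∀ x, G.Adj w x → x = b₁ ∨ x = b₂ ∨ x = c₁ ∨ x = c₂ := fun x hx => by
    rcases hall x with rfl | rfl | rfl | rfl | hx'
    · exact absurd rfl hx.ne
    · exact absurd ((hN w).1 hx.symm) (by tauto)
    · exact absurd ((hb w).1 hx.symm) (by tauto)
    · exact absurd ((hc w).1 hx.symm) (by tauto)
    · exact hx'
  obtain ⟨x, hx, y, hy, hxy⟩ : ∃ x, G.Adj w x ∧ ∃ y, G.Adj w y ∧ x ≠ y := by
    have h2 := h.two_le_degree w
    rw [← card_neighborFinset_eq_degree] at h2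
    obtain ⟨x, hx, y, hy, hxy⟩ := one_lt_card.1 h2
    exact ⟨x, by simpa using hx, y, by simpa using hy, hxy⟩
  have n1 : ¬ (G.Adj w b₁ ∧ G.Adj w c₁) := fun hh => h.triangle_free _ _ _ hh.1 m1 hh.2
  have n2 : ¬ (G.Adj w b₂ ∧ G.Adj w c₂) := fun hh => h.triangle_free _ _ _ hh.1 m2 hh.2
  have n3 : ¬ (G.Adj w b₁ ∧ G.Adj w b₂) := fun hh =>
    h.nonadj_matched hdeg hbb₁.symm hbb₂.symm m1 m2 hh.1 hh.2 hwN b4 b5 w2 w6 w7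
  have n4 : ¬ (G.Adj w c₁ ∧ G.Adj w c₂) := fun hh =>
    h.nonadj_matched hdeg hcc₁.symm hcc₂.symm m1.symm m2.symm hh.1 hh.2
      (fun x hx => by have := hwN x hx; tauto) c1 c2 w3 w4 w5
  have hcase : (G.Adj w b₁ ∧ G.Adj w c₂) ∨ (G.Adj w b₂ ∧ G.Adj w c₁) := by
    rcases hwN x hx with e | e | e | e <;> rcases hwN y hy with e' | e' | e' | e' <;>
      rw [e] at hx hxy <;> rw [e'] at hy hxy <;>
      first
      | exact absurd rfl hxy
      | exact Or.inl ⟨hx, hy⟩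
      | exact Or.inl ⟨hy, hx⟩
      | exact Or.inr ⟨hx, hy⟩
      | exact Or.inr ⟨hy, hx⟩
      | exact (n1 ⟨hx, hy⟩).elim
      | exact (n1 ⟨hy, hx⟩).elim
      | exact (n2 ⟨hx, hy⟩).elim
      | exact (n2 ⟨hy, hx⟩).elim
      | exact (n3 ⟨hx, hy⟩).elim
      | exact (n3 ⟨hy, hx⟩).elim
      | exact (n4 ⟨hx, hy⟩).elim
      | exact (n4 ⟨hy, hx⟩).elim
  -- The 8-cycle is `b p₂ q₂ w p₁ q₁ c a`, with antipodal chords `b p₁` and `c q₂`.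
  have cycle : ∀ p₁ p₂ q₁ q₂, G.Adj b p₁ → G.Adj b p₂ → G.Adj c q₁ → G.Adj c q₂ → G.Adj p₁ q₁ →
      G.Adj p₂ q₂ → G.Adj w p₁ → G.Adj w q₂ → [b, p₂, q₂, w, p₁, q₁, c, a].Nodup →
      ∃ f : Fin 8 → X, Function.Injective f ∧ ∀ i j, C8pp.Adj i j → G.Adj (f i) (f j) := by
    intro p₁ p₂ q₁ q₂ h1 h2 h3 h4 h5 h6 h7 h8 hn
    refine ⟨[b, p₂, q₂, w, p₁, q₁, c, a].get, List.nodup_iff_injective_get.1 hn,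
      C8pp_hom _ (fun i => ?_) h1 h4.symm⟩
    fin_cases i
    exacts [h2, h6, h8.symm, h7, h5, h3.symm, hac.symm, hab]
  rcases hcase with ⟨k1, k2⟩ | ⟨k1, k2⟩
  · refine cycle b₁ b₂ c₁ c₂ hbb₁ hbb₂ hcc₁ hcc₂ m1 m2 k1 k2 ?_
    simp only [List.nodup_cons, List.mem_cons, List.not_mem_nil, not_or, or_false,
      not_false_eq_true, List.nodup_nil, and_true]
    clear hdeg hall hN hb hc cycle hwN n1 n2 n3 n4 h
    grind
  · refine cycle b₂ b₁ c₂ c₁ hbb₂ hbb₁ hcc₂ hcc₁ m2 m1 k1 k2 ?_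
    simp only [List.nodup_cons, List.mem_cons, List.not_mem_nil, not_or, or_false,
      not_false_eq_true, List.nodup_nil, and_true]
    clear hdeg hall hN hb hc cycle hwN n1 n2 n3 n4 h
    grind

end IsClosedPair

theorem nonempty_iso_of_injective {V W : Type*} [Finite V] [Finite W] {G : SimpleGraph V}
    {H : SimpleGraph W} (f : V → W) (hf : Function.Injective f)
    (hadj : ∀ a b, G.Adj a b → H.Adj (f a) (f b)) (hcard : Nat.card W = Nat.card V)
    (hedge : H.edgeSet.ncard ≤ G.edgeSet.ncard) : Nonempty (H ≃g G) := by
  have hbij : Function.Bijective f := (Nat.bijective_iff_injective_and_card f).2 ⟨hf, hcard.symm⟩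
  have himg : Sym2.map f '' G.edgeSet = H.edgeSet := by
    refine Set.eq_of_subset_of_ncard_le ?_ ?_
    · rintro _ ⟨e, he, rfl⟩
      induction e with
      | _ a b => exact hadj a b he
    · rwa [Set.ncard_image_of_injective _ (Sym2.map.injective hf)]
  refine ⟨RelIso.symm ⟨Equiv.ofBijective f hbij, fun {a b} => ⟨fun h => ?_, hadj a b⟩⟩⟩
  have h1 : s(f a, f b) ∈ H.edgeSet := h
  rw [← himg] at h1
  obtain ⟨e, he, hab⟩ := h1
  have h2 : e = s(a, b) := Sym2.map.injective hf hab
  subst h2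
  exact he

theorem bound_lower {W : Type*} [Finite W] {B : SimpleGraph W} (hg : oddGirth B = 5)
    (hB : BoundsSP 5 B) : 8 ≤ Nat.card W ∧ 10 ≤ B.edgeSet.ncard ∧
      (Nat.card W = 8 → B.edgeSet.ncard = 10 → Nonempty (B ≃g C8pp)) := by
  classical
  obtain ⟨R, hsymm, hadj, ⟨a₀, b₀, h₀⟩, hext⟩ := exists_closed_relations hB
  have htri := (five_le_oddGirth_iff B).1 hg.ge
  let X := {a // ∃ b, R true a b}
  let G : SimpleGraph X :=
    { Adj := fun a b => R true a b
      symm := ⟨fun a b h => hsymm _ _ _ h⟩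
      loopless := ⟨fun a h => (hadj _ _ h).ne rfl⟩ }
  -- Ends of non-unit pairs also lie on unit pairs, so the restriction to `X` keeps all witnesses.
  have hmem : ∀ p a b, R p a b → ∃ c, R true a c := fun p a b h => by
    cases p
    · obtain ⟨c, hc, -⟩ := hext false true true rfl a b h
      exact ⟨c, hc⟩
    · exact ⟨b, h⟩
  have ext' : ∀ p q r, (p && q && r) = false → ∀ a b : X, R p a b →
      ∃ c : X, R q a c ∧ R r c b := fun p q r hpqr a b h => by
    obtain ⟨c, h1, h2⟩ := hext p q r hpqr a b h
    exact ⟨⟨c, hmem r c b h2⟩, h1, h2⟩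
  have hGD : IsClosedPair G (fun a b => R false a b) :=
    { triangle_free := fun a b c h1 h2 h3 => htri a b c (hadj _ _ h1) (hadj _ _ h2) (hadj _ _ h3)
      symm := fun a b h => hsymm _ _ _ h
      exists_adj := fun ⟨a, b, h⟩ => ⟨⟨b, a, hsymm _ _ _ h⟩, h⟩
      adj_left := ext' true true false rfl
      adj_none := ext' true false false rfl
      dist_both := ext' false true true rfl
      dist_left := ext' false true false rfl
      dist_none := ext' false false false rfl }
  have : Nonempty X := ⟨⟨a₀, b₀, h₀⟩⟩
  have := Fintype.ofFinite X
  have hX : Fintype.card X ≤ Nat.card W := by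
    rw [← Nat.card_eq_fintype_card]
    exact Finite.card_subtype_le _
  have hedge : G.edgeSet.ncard ≤ B.edgeSet.ncard := by
    rw [← Set.ncard_image_of_injective _ (Sym2.map.injective (Subtype.val_injective (p := _)))]
    refine Set.ncard_le_ncard ?_
    rintro _ ⟨e, he, rfl⟩
    induction e with
    | _ a b => exact hadj a b he
  have h8 := hGD.eight_le_card
  have h10 := hGD.ten_le_ncard_edgeSet
  refine ⟨by omega, by omega, fun hW hE => ?_⟩
  obtain ⟨f, hf, hfadj⟩ := hGD.exists_C8pp (by omega) (by omega)
  exact nonempty_iso_of_injective (fun i => (f i : W)) (Subtype.val_injective.comp hf)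
    (fun i j hij => hadj _ _ (hfadj i j hij)) (by simp [hW])
    (by rw [hE, ncard_edgeSet_C8pp])

end HomBounds

/-- `C₈⁺⁺` is a bound of odd-girth `5` for the class of `K₄`-minor-free graphs of odd-girth at
least `5`; it has `8` vertices and `10` edges; every finite bound of odd-girth `5` has at least `8`
vertices and at least `10` edges; and `C₈⁺⁺` is, up to isomorphism, the only one that attains both
minima. -/
theorem mainTheorem5 :
    HomBounds.BoundsSP 5 HomBounds.C8pp ∧
    HomBounds.oddGirth HomBounds.C8pp = 5 ∧
    HomBounds.C8pp.edgeSet.ncard = 10 ∧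
    ∀ (W : Type*) [Finite W] (B : SimpleGraph W),
      HomBounds.oddGirth B = 5 → HomBounds.BoundsSP 5 B →
        8 ≤ Nat.card W ∧
        10 ≤ B.edgeSet.ncard ∧
        (Nat.card W = 8 → B.edgeSet.ncard = 10 → Nonempty (B ≃g HomBounds.C8pp)) := by
  exact ⟨HomBounds.boundsSP_C8pp, HomBounds.oddGirth_C8pp, HomBounds.ncard_edgeSet_C8pp,
    fun _ _ _ hg hB => HomBounds.bound_lower hg hB⟩
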